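/- A deterministic two-party protocol is a binary tree in which each inner node is owned by Alice or Bob, who sends one bit depending on his or her own input and on the node, and each leaf carries an output bit. A randomized (public-coin) protocol is a probability distribution over deterministic protocols. We say that Alice (Bob) sends at most $a$ (at most $b$) bits if this holds for all inputs and all outcomes of the coins. Write $\lg=\log_2$. In lopsided set disjointness (LSD) with integer parameters $N,B\ge 1$, Alice receives $S\subseteq[N\cdot B]$ with $|S|=N$, Bob receives an arbitrary $T\subseteq[N\cdot B]$, and they must decide whether $S\cap T=\emptyset$. For even $B$, partition the universe into $N$ blocks of $B$ elements $(i,0),\dots,(i,B-1)$, $1\le i\le N$. Let $\mathcal S_i$ be the set of singletons in block $i$, and $\mathcal T_i$ the family of subsets of block $i$ that contain exactly one element of each pair $\{(i,2k),(i,2k+1)\}$, $0\le k<B/2$. For $1\le k\le N$ let $\mathcal D_k$ be the distribution of $(S,T)=(\bigcup_i S_i,\bigcup_i T_i)$ where the pairs $(S_i,T_i)$ are independent, $(S_k,T_k)$ is uniform on $\mathcal S_k\times\mathcal T_k$, and for $i\ne k$ the pair $(S_i,T_i)$ is uniform on the pairs in $\mathcal S_i\times\mathcal T_i$ with $S_i\cap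 T_i=\emptyset$. **Theorem.** 1. (Randomized bound.) For every $\varepsilon<\frac12$ there is a constant $C=C(\varepsilon)>0$ such that for every $\delta>0$ with $C\delta<1$ there is $B_0=B_0(\varepsilon,\delta)$ such that for all $N\ge1$ and $B\ge B_0$: if a randomized protocol for LSD errs with probability at most $\varepsilon$ on every input, Alice sends at most $a$ bits and Bob sends at most $b$ bits, then $a\ge\delta N\lg B$ or $b\ge N\cdot B^{1-C\delta}$. 2. (Distributional bound.) There is a universal constant $C>0$ such that for every $\delta>0$ with $C\delta<1$ there is $B_0=B_0(\delta)$ such that for all $N\ge1$ and all even $B\ge B_0$: if a (deterministic or randomized) protocol for LSD has error probability less than $\frac1{9999}$ on an input drawn from $\frac1N\sum_{i=1}^N\mathcal D_i$, Alice sends at most $a$ bits and Bob sends at most $b$ bits, then $a\ge\delta N\lg B$ or $b\ge N\cdot B^{1-C\delta}$. -/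

import Mathlib

open scoped ENNReal

noncomputable section

/-- A deterministic two-party communication protocol with one-bit messages. At an inner node the
speaker sends a bit that depends on the speaker's own input (and on the transcript so far, that is,
on the node). At a leaf the output is fixed. -/
inductive Protocol (X Y : Type) : Type where
  | output (v : Bool) : Protocol X Y
  | alice (msg : X → Bool) (next : Bool → Protocol X Y) : Protocol X Y
  | bob (msg : Y → Bool) (next : Bool → Protocol X Y) : Protocol X Y

namespace Protocol

variable {X Y : Type}

/-- The output of the protocol on the input `(x, y)`. -/
def run : Protocol X Y → X → Y → Bool
  | output v, _, _ => v
  | alice msg next, x, y => (next (msg x)).run x y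
  | bob msg next, x, y => (next (msg y)).run x y

/-- The number of bits that Alice sends on the input `(x, y)`. -/
def aliceBits : Protocol X Y → X → Y → ℕ
  | output _, _, _ => 0
  | alice msg next, x, y => (next (msg x)).aliceBits x y + 1
  | bob msg next, x, y => (next (msg y)).aliceBits x y

/-- The number of bits that Bob sends on the input `(x, y)`. -/
def bobBits : Protocol X Y → X → Y → ℕ
  | output _, _, _ => 0
  | alice msg next, x, y => (next (msg x)).bobBits x y
  | bob msg next, x, y => (next (msg y)).bobBits x y + 1

end Protocol

/-- A (public-coin) randomized protocol: a probability distribution over deterministic protocols.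
Private coins are a special case, since fixing all coins gives a deterministic protocol. -/
abbrev RandProtocol (X Y : Type) : Type := PMF (Protocol X Y)

namespace RandProtocol

variable {X Y : Type}

/-- Alice never sends more than `a` bits, whatever the input and the coins. -/
def AliceSendsAtMost (P : RandProtocol X Y) (a : ℕ) : Prop :=
  ∀ p ∈ P.support, ∀ x y, p.aliceBits x y ≤ a

/-- Bob never sends more than `b` bits, whatever the input and the coins. -/
def BobSendsAtMost (P : RandProtocol X Y) (b : ℕ) : Prop :=
  ∀ p ∈ P.support, ∀ x y, p.bobBits x y ≤ b

/-- The probability, over the coins, that the output on `(x, y)` differs from `f x y`. -/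
def errorProb (P : RandProtocol X Y) (f : X → Y → Bool) (x : X) (y : Y) : ℝ≥0∞ :=
  P.toOuterMeasure {p | p.run x y ≠ f x y}

/-- The error probability when the input is drawn from `D`, independently of the coins. -/
def distError (P : RandProtocol X Y) (f : X → Y → Bool) (D : PMF (X × Y)) : ℝ≥0∞ :=
  ∑' z : X × Y, D z * P.errorProb f z.1 z.2

end RandProtocol

namespace LSD

/-- Alice's inputs: the `N`-element subsets of a universe of `N * B` elements. -/
abbrev AliceInput (N B : ℕ) : Type := {S : Finset (Fin (N * B)) // S.card = N}

/-- Bob's inputs: all subsets of the universe. -/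
abbrev BobInput (N B : ℕ) : Type := Finset (Fin (N * B))

/-- Lopsided set disjointness: are `S` and `T` disjoint? -/
def disj (N B : ℕ) (S : AliceInput N B) (T : BobInput N B) : Bool :=
  decide (Disjoint S.1 T)

/-- The `j`-th element of the `i`-th block, in the partition of the universe into `N` blocks of
`B` consecutive elements. -/
def elt {N B : ℕ} (i : Fin N) (j : Fin B) : Fin (N * B) := finProdFinEquiv (i, j)

/-- The possible restrictions of Bob's set to a block (identified with `Fin B`): sets that contain
exactly one element of each pair `{2k, 2k+1}`. -/
def bobBlocks (B : ℕ) : Finset (Finset (Fin B)) :=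
  Finset.univ.filter fun t =>
    ∀ j j' : Fin B, Even (j : ℕ) → (j' : ℕ) = j + 1 → Xor (j ∈ t) (j' ∈ t)

/-- The possible pairs of one block: Alice's single element and Bob's set. -/
def blockPairs (B : ℕ) : Finset (Fin B × Finset (Fin B)) :=
  Finset.univ ×ˢ bobBlocks B

/-- The pairs of one block for which Alice's element does not lie in Bob's set. -/
def disjBlockPairs (B : ℕ) : Finset (Fin B × Finset (Fin B)) :=
  (blockPairs B).filter fun p => p.1 ∉ p.2

/-- Alice's set, with exactly one element in each block. -/
def assembleAlice {N B : ℕ} (w : Fin N → Fin B × Finset (Fin B)) : AliceInput N B :=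
  ⟨Finset.univ.image fun i => elt i (w i).1, by
    rw [Finset.card_image_of_injective]
    · simp
    · intro i i' h
      exact congrArg Prod.fst (finProdFinEquiv.injective h)⟩

/-- Bob's set, the union over the blocks of his sets in the blocks. -/
def assembleBob {N B : ℕ} (w : Fin N → Fin B × Finset (Fin B)) : BobInput N B :=
  Finset.univ.biUnion fun i => (w i).2.image fun j => elt i j

/-- The choices of a pair for every block: any pair in the designated block `k`, a disjoint pair in
every other block. -/
def hardChoices (N B : ℕ) (k : Fin N) : Finset (Fin N → Fin B × Finset (Fin B)) :=
  Fintype.piFinset fun i => if i = k then blockPairs B else disjBlockPairs B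

theorem disjBlockPairs_nonempty (B : ℕ) [NeZero B] : (disjBlockPairs B).Nonempty := by
  refine ⟨(0, Finset.univ.filter fun j : Fin B => ¬ Even (j : ℕ)), ?_⟩
  simp only [disjBlockPairs, blockPairs, bobBlocks, Finset.mem_filter, Finset.mem_product,
    Finset.mem_univ, true_and]
  refine ⟨fun j j' hj hj' => Or.inr ⟨?_, ?_⟩, ?_⟩
  · rw [hj', Nat.even_add_one]
    exact fun h => h hj
  · exact fun h => h hj
  · simp

theorem hardChoices_nonempty (N B : ℕ) [NeZero B] (k : Fin N) : (hardChoices N B k).Nonempty := by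
  refine Fintype.piFinset_nonempty.2 fun i => ?_
  have h := disjBlockPairs_nonempty B
  split_ifs
  · exact h.mono (Finset.filter_subset _ _)
  · exact h

/-- The distribution with designated block `k`: the blocks are independent; the pair of block `k` is
uniform among all pairs, and the pair of each other block is uniform among the disjoint pairs.
(The uniform distribution on a product of finite sets has independent uniform coordinates.) -/
def hardDist (N B : ℕ) [NeZero B] (k : Fin N) : PMF (AliceInput N B × BobInput N B) :=
  (PMF.uniformOfFinset (hardChoices N B k) (hardChoices_nonempty N B k)).map
    fun w => (assembleAlice w, assembleBob w)

/-- The mixture `(1/N) ∑ₖ Dₖ` of the distributions with a designated block. -/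
def hardMixture (N B : ℕ) [NeZero N] [NeZero B] : PMF (AliceInput N B × BobInput N B) :=
  (PMF.uniformOfFintype (Fin N)).bind fun k => hardDist N B k

end LSD

end

/-! The argument is a corruption bound with information costs. Take one block and a product function
`f ⊗ g`, such as the indicator of a rectangle. Unless `f` or `g` carries much information, its mass
on intersecting pairs is at least a constant fraction of its mass on disjoint pairs.
`block_corruption` states this as a linear inequality with prices `A⁻¹` and `Q⁻¹` per unit of
Alice's and Bob's information. The reason is that little information from Bob leaves all but about
`Q` of the pairs balanced: either element is in his set with constant probability. To concentrate on
the few remaining pairs, Alice needs information of order `log (n / Q)`, where `n` is the number of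
pairs in the block. Otherwise she often hits a balanced pair, and then the two sets intersect with
constant probability. Linearity lets the inequality tensorize: by the chain rule, information in a
product of blocks is exactly the sum of the conditional informations, so `CorruptionBound.prod` adds
the constants and keeps the prices. Over a protocol tree, each bit raises the sender's total
information by at most `log 2` times the mass and leaves the other party's total unchanged
(`CorruptionBound.protocol`). At accepting leaves the corruption inequality applies, at rejecting
leaves nonnegativity of information. On the hard mixture a small error means that most of the
disjoint mass is accepted and little of the intersecting mass is. Hence `a / A + b / Q` is at least
of order `N`. With `A` of order `δ lg B` and `Q` of order `B ^ (1 - 19δ)` this is the distributional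
bound. The randomized bound follows by amplification through majorities and by averaging over the
coins. -/

namespace LSD

open Real

/-! ### Corruption bounds and their tensorization over blocks -/

section Blocks

variable {X Y : Type}

/-- The product weight on `N` blocks. -/
def blockProd (w : X → Y → ℝ) (N : ℕ) (x : Fin N → X) (y : Fin N → Y) : ℝ :=
  ∏ i, w (x i) (y i)

/-- The sum over `k` of the product weights in which block `k` has weight `w'`. -/
def blockSum (w w' : X → Y → ℝ) (N : ℕ) (x : Fin N → X) (y : Fin N → Y) : ℝ :=
  ∑ k, ∏ i, if i = k then w' (x i) (y i) else w (x i) (y i)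

theorem blockProd_succ (w : X → Y → ℝ) (N : ℕ) (x : Fin (N + 1) → X) (y : Fin (N + 1) → Y) :
    blockProd w (N + 1) x y = w (x 0) (y 0) * blockProd w N (Fin.tail x) (Fin.tail y) :=
  Fin.prod_univ_succ _

theorem blockSum_succ (w w' : X → Y → ℝ) (N : ℕ) (x : Fin (N + 1) → X) (y : Fin (N + 1) → Y) :
    blockSum w w' (N + 1) x y = w' (x 0) (y 0) * blockProd w N (Fin.tail x) (Fin.tail y) +
      w (x 0) (y 0) * blockSum w w' N (Fin.tail x) (Fin.tail y) := by
  simp only [blockSum, blockProd, Fin.sum_univ_succ, Fin.prod_univ_succ, Finset.mul_sum,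
    Fin.succ_ne_zero, if_true, if_false, Fin.succ_inj, (Fin.succ_ne_zero _).symm, Fin.tail]

end Blocks

section Tensor

variable {X Y X₁ Y₁ X₂ Y₂ : Type} [Fintype X] [Fintype Y] [Fintype X₁] [Fintype Y₁] [Fintype X₂]
  [Fintype Y₂]

/-- The mass that the weight `w` gives to the product function `f ⊗ g`. -/
noncomputable def bil (w : X → Y → ℝ) (f : X → ℝ) (g : Y → ℝ) : ℝ :=
  ∑ x, ∑ y, w x y * (f x * g y)

/-- The unnormalised information that `f` carries about Alice's input, given Bob's input. -/
noncomputable def entA (w : X → Y → ℝ) (f : X → ℝ) (g : Y → ℝ) : ℝ :=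
  bil (fun x y => w x y * (log (f x) - log (∑ x', w x' y * f x'))) f g

/-- The unnormalised information that `g` carries about Bob's input, given Alice's input. -/
noncomputable def entB (w : X → Y → ℝ) (f : X → ℝ) (g : Y → ℝ) : ℝ :=
  bil (fun x y => w x y * (log (g y) - log (∑ y', w x y' * g y'))) f g

/-- Product functions carry much `w'`-mass compared with their `w`-mass, unless they carry much
information. -/
def CorruptionBound (w w' : X → Y → ℝ) (c l r : ℝ) : Prop :=
  ∀ f g, (∀ x, 0 ≤ f x) → (∀ y, 0 ≤ g y) →
    c * bil w f g ≤ bil w' f g + l * entA w f g + r * entB w f g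

theorem bil_add_weight (w w' : X → Y → ℝ) (f : X → ℝ) (g : Y → ℝ) :
    bil (fun x y => w x y + w' x y) f g = bil w f g + bil w' f g := by
  simp only [bil, ← Finset.sum_add_distrib, add_mul]

theorem bil_prod_left (v₁ : X₁ → Y₁ → Y₂ → ℝ) (w₂ : X₂ → Y₂ → ℝ) (f : X₁ × X₂ → ℝ)
    (g : Y₁ × Y₂ → ℝ) :
    bil (fun x y => v₁ x.1 y.1 y.2 * w₂ x.2 y.2) f g =
      ∑ y₂, bil (fun x₁ y₁ => v₁ x₁ y₁ y₂) (fun x₁ => ∑ x₂, w₂ x₂ y₂ * f (x₁, x₂))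
        (fun y₁ => g (y₁, y₂)) := by
  simp only [bil, Fintype.sum_prod_type, Finset.sum_mul, Finset.mul_sum]
  conv_rhs => rw [Finset.sum_comm]
  refine Finset.sum_congr rfl fun x₁ _ => ?_
  conv_lhs => rw [Finset.sum_comm]
  conv_rhs => rw [Finset.sum_comm]
  refine Finset.sum_congr rfl fun y₁ _ => ?_
  rw [Finset.sum_comm]
  refine Finset.sum_congr rfl fun y₂ _ => Finset.sum_congr rfl fun x₂ _ => ?_
  ring

theorem bil_prod_right (w₁ : X₁ → Y₁ → ℝ) (v₂ : X₁ → X₂ → Y₂ → ℝ) (f : X₁ × X₂ → ℝ)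
    (g : Y₁ × Y₂ → ℝ) :
    bil (fun x y => w₁ x.1 y.1 * v₂ x.1 x.2 y.2) f g =
      ∑ x₁, bil (fun x₂ y₂ => v₂ x₁ x₂ y₂) (fun x₂ => f (x₁, x₂))
        (fun y₂ => ∑ y₁, w₁ x₁ y₁ * g (y₁, y₂)) := by
  simp only [bil, Fintype.sum_prod_type, Finset.mul_sum]
  refine Finset.sum_congr rfl fun x₁ _ => Finset.sum_congr rfl fun x₂ _ => ?_
  rw [Finset.sum_comm]
  refine Finset.sum_congr rfl fun y₂ _ => Finset.sum_congr rfl fun y₁ _ => ?_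
  ring

/-- Freeze `y₂` and average Alice's second coordinate to get an instance for block 1; freeze `x₁`
and average Bob's first coordinate to get one for block 2. The chain rule makes both informations
add up exactly to those of `f` and `g`. In the mixed weight each summand has one corrupted block,
which is why the constants add. -/
theorem CorruptionBound.prod {w₁ w₁' : X₁ → Y₁ → ℝ} {w₂ w₂' : X₂ → Y₂ → ℝ} {c₁ c₂ l r : ℝ}
    (hw₁ : ∀ x y, 0 ≤ w₁ x y) (hw₂ : ∀ x y, 0 ≤ w₂ x y)
    (h₁ : CorruptionBound w₁ w₁' c₁ l r) (h₂ : CorruptionBound w₂ w₂' c₂ l r) :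
    CorruptionBound (X := X₁ × X₂) (Y := Y₁ × Y₂) (fun x y => w₁ x.1 y.1 * w₂ x.2 y.2)
      (fun x y => w₁' x.1 y.1 * w₂ x.2 y.2 + w₁ x.1 y.1 * w₂' x.2 y.2) (c₁ + c₂) l r := by
  intro f g hf hg
  -- The two chain rules run in opposite orders: Alice's information is revealed as `x₁`, then `x₂`,
  -- Bob's as `y₂`, then `y₁`. This keeps a product function in each block once the other variables
  -- are fixed. The terms `log F` and `log G` telescope.
  set F : Y₂ → X₁ → ℝ := fun y₂ x₁ => ∑ x₂, w₂ x₂ y₂ * f (x₁, x₂) with hF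
  set G : X₁ → Y₂ → ℝ := fun x₁ y₂ => ∑ y₁, w₁ x₁ y₁ * g (y₁, y₂) with hG
  have key₁ := Finset.sum_le_sum fun (y₂ : Y₂) (_ : y₂ ∈ Finset.univ) =>
    h₁ (F y₂) (fun y₁ => g (y₁, y₂))
      (fun x₁ => Finset.sum_nonneg fun x₂ _ => mul_nonneg (hw₂ _ _) (hf _)) (fun y₁ => hg _)
  have key₂ := Finset.sum_le_sum fun (x₁ : X₁) (_ : x₁ ∈ Finset.univ) =>
    h₂ (fun x₂ => f (x₁, x₂)) (G x₁) (fun x₂ => hf _)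
      (fun y₂ => Finset.sum_nonneg fun y₁ _ => mul_nonneg (hw₁ _ _) (hg _))
  have eA : entA (X := X₁ × X₂) (Y := Y₁ × Y₂) (fun x y => w₁ x.1 y.1 * w₂ x.2 y.2) f g =
      ∑ y₂, entA w₁ (F y₂) (fun y₁ => g (y₁, y₂)) +
        ∑ x₁, entA w₂ (fun x₂ => f (x₁, x₂)) (G x₁) := by
    have hK : ∀ y : Y₁ × Y₂, ∑ x : X₁ × X₂, w₁ x.1 y.1 * w₂ x.2 y.2 * f x =
        ∑ x₁, w₁ x₁ y.1 * F y.2 x₁ := fun y => by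
      simp only [hF, Fintype.sum_prod_type, Finset.mul_sum, mul_assoc]
    simp only [entA]
    rw [← bil_prod_left (fun x₁ y₁ y₂ => w₁ x₁ y₁ *
        (log (F y₂ x₁) - log (∑ x', w₁ x' y₁ * F y₂ x'))),
      ← bil_prod_right w₁ (fun x₁ x₂ y₂ => w₂ x₂ y₂ *
        (log (f (x₁, x₂)) - log (∑ x', w₂ x' y₂ * f (x₁, x')))), ← bil_add_weight]
    congr 1
    funext x y
    rw [hK y]
    simp only [hF]
    ring
  have eB : entB (X := X₁ × X₂) (Y := Y₁ × Y₂) (fun x y => w₁ x.1 y.1 * w₂ x.2 y.2) f g =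
      ∑ y₂, entB w₁ (F y₂) (fun y₁ => g (y₁, y₂)) +
        ∑ x₁, entB w₂ (fun x₂ => f (x₁, x₂)) (G x₁) := by
    have hK : ∀ x : X₁ × X₂, ∑ y : Y₁ × Y₂, w₁ x.1 y.1 * w₂ x.2 y.2 * g y =
        ∑ y₂, w₂ x.2 y₂ * G x.1 y₂ := fun x => by
      simp only [hG, Fintype.sum_prod_type, Finset.mul_sum]
      rw [Finset.sum_comm]
      refine Finset.sum_congr rfl fun y₂ _ => Finset.sum_congr rfl fun y₁ _ => ?_
      ring
    simp only [entB]
    rw [← bil_prod_left (fun x₁ y₁ y₂ => w₁ x₁ y₁ *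
        (log (g (y₁, y₂)) - log (∑ y', w₁ x₁ y' * g (y', y₂)))),
      ← bil_prod_right w₁ (fun x₁ x₂ y₂ => w₂ x₂ y₂ *
        (log (G x₁ y₂) - log (∑ y', w₂ x₂ y' * G x₁ y'))), ← bil_add_weight]
    congr 1
    funext x y
    rw [hK x]
    simp only [hG]
    ring
  have e₁ := bil_prod_left (fun x₁ y₁ (_ : Y₂) => w₁ x₁ y₁) w₂ f g
  have e₂ := bil_prod_right w₁ (fun (_ : X₁) x₂ y₂ => w₂ x₂ y₂) f g
  have e₃ := bil_prod_left (fun x₁ y₁ (_ : Y₂) => w₁' x₁ y₁) w₂ f g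
  have e₄ := bil_prod_right w₁ (fun (_ : X₁) x₂ y₂ => w₂' x₂ y₂) f g
  rw [bil_add_weight, eA, eB, e₃, e₄, add_mul]
  nth_rw 1 [e₁]
  rw [e₂]
  simp only [Finset.sum_add_distrib, ← Finset.mul_sum] at key₁ key₂
  linarith

theorem CorruptionBound.of_equiv {w w' : X → Y → ℝ} {c l r : ℝ} (h : CorruptionBound w w' c l r)
    (eX : X₁ ≃ X) (eY : Y₁ ≃ Y) :
    CorruptionBound (fun x y => w (eX x) (eY y)) (fun x y => w' (eX x) (eY y)) c l r := by
  have hb : ∀ (v : X₁ → Y₁ → ℝ) f g, bil v f g =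
      bil (fun x y => v (eX.symm x) (eY.symm y)) (f ∘ eX.symm) (g ∘ eY.symm) := by
    intro v f g
    refine Fintype.sum_equiv eX _ _ fun x => Fintype.sum_equiv eY _ _ fun y => ?_
    simp
  intro f g hf hg
  have hA : ∀ y, ∑ x, w (eX x) y * f x = ∑ x, w x y * (f ∘ eX.symm) x := fun y =>
    Fintype.sum_equiv eX _ _ fun x => by simp
  have hB : ∀ x, ∑ y, w x (eY y) * g y = ∑ y, w x y * (g ∘ eY.symm) y := fun y =>
    Fintype.sum_equiv eY _ _ fun x => by simp
  have := h (f ∘ eX.symm) (g ∘ eY.symm) (fun x => hf _) (fun y => hg _)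
  simp only [entA, entB, hA, hB] at this ⊢
  rw [hb, hb, hb, hb]
  simpa using this

theorem CorruptionBound.pow {w w' : X → Y → ℝ} {c l r : ℝ} (hw : ∀ x y, 0 ≤ w x y)
    (h : CorruptionBound w w' c l r) (N : ℕ) :
    CorruptionBound (blockProd w N) (blockSum w w' N) (N * c) l r := by
  induction N with
  | zero =>
    intro f g _ _
    simp [bil, entA, entB, blockProd, blockSum]
  | succ N ih =>
    have hW : ∀ x y, 0 ≤ blockProd w N x y := fun x y => Finset.prod_nonneg fun i _ => hw _ _
    have := (h.prod hw hW ih).of_equiv (Fin.consEquiv fun _ : Fin (N + 1) => X).symm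
      (Fin.consEquiv fun _ : Fin (N + 1) => Y).symm
    have e₁ : (N + 1 : ℕ) * c = c + N * c := by push_cast; ring
    have e₂ : blockProd w (N + 1) = fun x y => w (x 0) (y 0) *
      blockProd w N (Fin.tail x) (Fin.tail y) := by funext x y; exact blockProd_succ _ _ _ _
    have e₃ : blockSum w w' (N + 1) = fun x y => w' (x 0) (y 0) *
        blockProd w N (Fin.tail x) (Fin.tail y) + w (x 0) (y 0) *
        blockSum w w' N (Fin.tail x) (Fin.tail y) := by
      funext x y; exact blockSum_succ _ _ _ _ _
    rw [e₁, e₂, e₃]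
    exact this

end Tensor

end LSD

/-! ### Translating the inputs of a protocol -/

namespace Protocol

variable {X Y X' Y' : Type}

/-- The protocol in which the parties first translate their inputs. -/
def comap (u : X' → X) (v : Y' → Y) : Protocol X Y → Protocol X' Y'
  | output o => output o
  | alice msg next => alice (msg ∘ u) fun b => (next b).comap u v
  | bob msg next => bob (msg ∘ v) fun b => (next b).comap u v

theorem run_comap (u : X' → X) (v : Y' → Y) (p : Protocol X Y) (x : X') (y : Y') :
    (p.comap u v).run x y = p.run (u x) (v y) := by
  induction p with
  | output o => rfl
  | alice msg next ih => exact ih _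
  | bob msg next ih => exact ih _

theorem aliceBits_comap (u : X' → X) (v : Y' → Y) (p : Protocol X Y) (x : X') (y : Y') :
    (p.comap u v).aliceBits x y = p.aliceBits (u x) (v y) := by
  induction p with
  | output o => rfl
  | alice msg next ih => exact congrArg (· + 1) (ih _)
  | bob msg next ih => exact ih _

theorem bobBits_comap (u : X' → X) (v : Y' → Y) (p : Protocol X Y) (x : X') (y : Y') :
    (p.comap u v).bobBits x y = p.bobBits (u x) (v y) := by
  induction p with
  | output o => rfl
  | alice msg next ih => exact ih _
  | bob msg next ih => exact congrArg (· + 1) (ih _)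

end Protocol

namespace LSD

open Real

/-! ### Entropy and exponential moments -/

section Gibbs

variable {X : Type} [Fintype X]

/-- The variational inequality between an entropy and an exponential moment. -/
theorem gibbs_variational {w f : X → ℝ} (hw : ∀ x, 0 ≤ w x) (hf : ∀ x, 0 ≤ f x) (φ : X → ℝ) :
    ∑ x, w x * f x * φ x ≤ ∑ x, w x * f x * (log (f x) - log (∑ x', w x' * f x')) +
      (∑ x, w x * f x) * log (∑ x, w x * exp (φ x)) := by
  set K := ∑ x, w x * f x with hK
  set E := ∑ x, w x * exp (φ x) with hE
  have hwf : ∀ x, 0 ≤ w x * f x := fun x => mul_nonneg (hw x) (hf x)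
  have hK0 : 0 ≤ K := Finset.sum_nonneg fun x _ => hwf x
  rcases hK0.eq_or_lt with h0 | hKpos
  · have hz : ∀ x, w x * f x = 0 := fun x =>
      (Finset.sum_eq_zero_iff_of_nonneg fun x _ => hwf x).1 h0.symm x (Finset.mem_univ x)
    simp [hz, ← h0]
  have hEpos : 0 < E := by
    obtain ⟨x, -, hx⟩ := Finset.exists_lt_of_sum_lt (s := Finset.univ) (f := fun _ : X => (0 : ℝ))
      (g := fun x => w x * f x) (by simpa using hKpos)
    have hwx : 0 < w x := lt_of_le_of_ne (hw x) fun h => by simp [← h] at hx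
    exact Finset.sum_pos' (fun x _ => mul_nonneg (hw x) (exp_pos _).le)
      ⟨x, Finset.mem_univ x, mul_pos hwx (exp_pos _)⟩
  have hterm : ∀ x, w x * f x * φ x - w x * f x * (log (f x) - log K) - w x * f x * log E ≤
      w x * exp (φ x) * (K / E) - w x * f x := by
    intro x
    -- Where `f x = 0` the left side vanishes, whatever value the logarithm takes at zero. Elsewhere
    -- the bound is `log t ≤ t - 1`, with `t` the ratio of the tilted density `exp φ / E` to the
    -- density `f / K`.
    rcases (hf x).eq_or_lt with h0 | hpos
    · rw [← h0]
      have := mul_nonneg (mul_nonneg (hw x) (exp_pos (φ x)).le) (div_pos hKpos hEpos).le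
      simpa using this
    · have h1 := log_le_sub_one_of_pos (x := exp (φ x) * K / (f x * E)) (by positivity)
      rw [log_div (by positivity) (by positivity), log_mul (by positivity) (by positivity),
        log_mul (by positivity) (by positivity), log_exp] at h1
      have h2 := mul_le_mul_of_nonneg_left h1 (hwf x)
      have h3 : w x * f x * (exp (φ x) * K / (f x * E) - 1) =
          w x * exp (φ x) * (K / E) - w x * f x := by
        field_simp
      rw [h3] at h2
      linarith
  have hsum := Finset.sum_le_sum fun x (_ : x ∈ Finset.univ) => hterm x
  simp only [Finset.sum_sub_distrib, ← Finset.sum_mul] at hsum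
  rw [← hE, ← hK, mul_div_cancel₀ _ hEpos.ne'] at hsum
  linarith

theorem entropy_nonneg {w f : X → ℝ} (hw : ∀ x, 0 ≤ w x) (hf : ∀ x, 0 ≤ f x) :
    0 ≤ ∑ x, w x * f x * (log (f x) - log (∑ x', w x' * f x')) +
      (∑ x, w x * f x) * log (∑ x, w x) := by
  simpa using gibbs_variational hw hf 0

end Gibbs

/-! ### Information along a protocol tree -/

section Entropy

variable {X Y : Type} [Fintype X] [Fintype Y]

theorem bil_swap (w : X → Y → ℝ) (f : X → ℝ) (g : Y → ℝ) :
    bil w f g = bil (fun y x => w x y) g f := by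
  simp only [bil]
  rw [Finset.sum_comm]
  simp only [mul_comm (f _)]

theorem entB_eq_entA_swap (w : X → Y → ℝ) (f : X → ℝ) (g : Y → ℝ) :
    entB w f g = entA (fun y x => w x y) g f := by
  rw [entB, entA, bil_swap]

theorem bil_eq_sum_right (w : X → Y → ℝ) (f : X → ℝ) (g : Y → ℝ) :
    bil w f g = ∑ y, g y * ∑ x, w x y * f x := by
  rw [bil, Finset.sum_comm]
  simp only [Finset.mul_sum]
  exact Finset.sum_congr rfl fun y _ => Finset.sum_congr rfl fun x _ => by ring

theorem bil_eq_sum_left (w : X → Y → ℝ) (f : X → ℝ) (g : Y → ℝ) :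
    bil w f g = ∑ x, f x * ∑ y, w x y * g y := by
  rw [bil_swap, bil_eq_sum_right]

theorem entA_eq_sum (w : X → Y → ℝ) (f : X → ℝ) (g : Y → ℝ) :
    entA w f g = ∑ y, g y * ∑ x, w x y * f x * (log (f x) - log (∑ x', w x' y * f x')) := by
  rw [entA, bil_eq_sum_right]
  simp only [mul_right_comm]

theorem entB_eq_sum (w : X → Y → ℝ) (f : X → ℝ) (g : Y → ℝ) :
    entB w f g = ∑ x, f x * ∑ y, w x y * g y * (log (g y) - log (∑ y', w x y' * g y')) := by
  rw [entB_eq_entA_swap, entA_eq_sum]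

/-- The weights are not normalised: the term with `log d` turns `entA` into a genuine relative
entropy with respect to the conditional distribution of `x` given `y`. -/
theorem entA_add_nonneg {w : X → Y → ℝ} {f : X → ℝ} {g : Y → ℝ} {d : ℝ}
    (hw : ∀ x y, 0 ≤ w x y) (hd : ∀ y, ∑ x, w x y = d) (hf : ∀ x, 0 ≤ f x) (hg : ∀ y, 0 ≤ g y) :
    0 ≤ entA w f g + log d * bil w f g := by
  rw [entA_eq_sum, bil_eq_sum_right, Finset.mul_sum, ← Finset.sum_add_distrib]
  refine Finset.sum_nonneg fun y _ => ?_
  have := mul_nonneg (hg y) (entropy_nonneg (fun x => hw x y) hf)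
  rw [hd y] at this
  linarith

theorem entB_add_nonneg {w : X → Y → ℝ} {f : X → ℝ} {g : Y → ℝ} {d : ℝ}
    (hw : ∀ x y, 0 ≤ w x y) (hd : ∀ x, ∑ y, w x y = d) (hf : ∀ x, 0 ≤ f x) (hg : ∀ y, 0 ≤ g y) :
    0 ≤ entB w f g + log d * bil w f g := by
  rw [entB_eq_entA_swap, bil_swap]
  exact entA_add_nonneg (fun y x => hw x y) hd hg hf

/-- This is the inequality for rejecting leaves, where nothing better than nonnegativity of
information is available. -/
theorem corruptionBound_zero {w : X → Y → ℝ} {l r dX dY : ℝ} (hw : ∀ x y, 0 ≤ w x y)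
    (hl : 0 ≤ l) (hr : 0 ≤ r) (hX : ∀ y, ∑ x, w x y = dX) (hY : ∀ x, ∑ y, w x y = dY) :
    CorruptionBound w (fun _ _ => 0) (-(l * log dX) - r * log dY) l r := by
  intro f g hf hg
  have h1 := mul_nonneg hl (entA_add_nonneg hw hX hf hg)
  have h2 := mul_nonneg hr (entB_add_nonneg hw hY hf hg)
  have h3 : bil (fun (_ : X) (_ : Y) => (0 : ℝ)) f g = 0 := by simp [bil]
  rw [h3]
  linarith

theorem entA_one {w : X → Y → ℝ} {d : ℝ} (hd : ∀ y, ∑ x, w x y = d) :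
    entA w (fun _ => 1) (fun _ => 1) = -(log d * bil w (fun _ => 1) (fun _ => 1)) := by
  simp only [entA, mul_one, hd, log_one, zero_sub, mul_neg, bil, Finset.sum_neg_distrib,
    ← Finset.sum_mul]
  ring

theorem entB_one {w : X → Y → ℝ} {d : ℝ} (hd : ∀ x, ∑ y, w x y = d) :
    entB w (fun _ => 1) (fun _ => 1) = -(log d * bil w (fun _ => 1) (fun _ => 1)) := by
  rw [entB_eq_entA_swap, bil_swap, entA_one hd]

/-- The part of `f` on the inputs with message `b`. -/
def restrict (msg : X → Bool) (f : X → ℝ) (b : Bool) (x : X) : ℝ :=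
  if msg x = b then f x else 0

omit [Fintype X] in
theorem restrict_nonneg {msg : X → Bool} {f : X → ℝ} (hf : ∀ x, 0 ≤ f x) (b : Bool) (x : X) :
    0 ≤ restrict msg f b x := by
  unfold restrict
  split_ifs
  exacts [hf x, le_rfl]

/-- The kernel may depend on the message, so that the two children of a node can contribute
different costs and outputs. -/
theorem bil_split (k : Bool → X → Y → ℝ) (msg : X → Bool) (f : X → ℝ) (g : Y → ℝ) :
    bil (fun x y => k (msg x) x y) f g =
      bil (k true) (restrict msg f true) g + bil (k false) (restrict msg f false) g := by
  simp only [bil, ← Finset.sum_add_distrib]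
  refine Finset.sum_congr rfl fun x _ => Finset.sum_congr rfl fun y _ => ?_
  cases h : msg x <;> simp [restrict, h]

/-- Midpoint convexity of `t log t`; equivalently, one bit has entropy at most `log 2`. -/
theorem mul_log_add_le {u v : ℝ} (hu : 0 ≤ u) (hv : 0 ≤ v) :
    (u + v) * log (u + v) ≤ u * log u + v * log v + log 2 * (u + v) := by
  rcases (add_nonneg hu hv).eq_or_lt with h | h
  · rw [show u = 0 by linarith, show v = 0 by linarith]
    simp
  have := Real.convexOn_mul_log.2 (Set.mem_Ici.2 hu) (Set.mem_Ici.2 hv)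
    (show (0 : ℝ) ≤ 1 / 2 by norm_num) (show (0 : ℝ) ≤ 1 / 2 by norm_num) (by norm_num)
  simp only [smul_eq_mul] at this
  rw [show 1 / 2 * u + 1 / 2 * v = (u + v) / 2 by ring, log_div h.ne' two_ne_zero] at this
  linarith

/-- The terms `f log f` are additive because the two parts have disjoint supports. Only the
normalising term `K log K` changes, and `mul_log_add_le` bounds its change. -/
theorem entA_split_le {w : X → Y → ℝ} {f : X → ℝ} {g : Y → ℝ} (hw : ∀ x y, 0 ≤ w x y)
    (hf : ∀ x, 0 ≤ f x) (hg : ∀ y, 0 ≤ g y) (msg : X → Bool) :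
    entA w (restrict msg f true) g + entA w (restrict msg f false) g ≤
      entA w f g + log 2 * bil w f g := by
  simp only [entA_eq_sum, bil_eq_sum_right, Finset.mul_sum (a := log 2),
    ← Finset.sum_add_distrib]
  refine Finset.sum_le_sum fun y _ => ?_
  simp only [mul_left_comm (log 2), ← mul_add]
  refine mul_le_mul_of_nonneg_left ?_ (hg y)
  have hadd : ∑ x, w x y * f x = ∑ x, w x y * restrict msg f true x +
      ∑ x, w x y * restrict msg f false x := by
    rw [← Finset.sum_add_distrib]
    refine Finset.sum_congr rfl fun x _ => ?_
    cases h : msg x <;> simp [restrict, h]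
  have hlog : ∑ x, w x y * f x * log (f x) =
      ∑ x, w x y * restrict msg f true x * log (restrict msg f true x) +
      ∑ x, w x y * restrict msg f false x * log (restrict msg f false x) := by
    rw [← Finset.sum_add_distrib]
    refine Finset.sum_congr rfl fun x _ => ?_
    cases h : msg x <;> simp [restrict, h]
  have := mul_log_add_le
    (Finset.sum_nonneg fun x (_ : x ∈ Finset.univ) =>
      mul_nonneg (hw x y) (restrict_nonneg (msg := msg) hf true x))
    (Finset.sum_nonneg fun x (_ : x ∈ Finset.univ) =>
      mul_nonneg (hw x y) (restrict_nonneg (msg := msg) hf false x))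
  simp only [mul_sub, Finset.sum_sub_distrib, ← Finset.sum_mul]
  rw [hlog, hadd]
  linarith

/-- Bob's information is measured for each input of Alice separately, so it is linear in `f` and her
messages do not affect its total. -/
theorem entB_split (w : X → Y → ℝ) (f : X → ℝ) (g : Y → ℝ) (msg : X → Bool) :
    entB w (restrict msg f true) g + entB w (restrict msg f false) g = entB w f g :=
  (bil_split (fun _ => _) msg f g).symm

theorem bil_split_right (k : Bool → X → Y → ℝ) (msg : Y → Bool) (f : X → ℝ) (g : Y → ℝ) :
    bil (fun x y => k (msg y) x y) f g =
      bil (k true) f (restrict msg g true) + bil (k false) f (restrict msg g false) := by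
  rw [bil_swap, bil_split (fun b y x => k b x y), bil_swap (k true), bil_swap (k false)]

/-- The inequality for product functions, summed over the leaves of a protocol. -/
theorem CorruptionBound.protocol {w w' : X → Y → ℝ} {c c₀ l r : ℝ} (hw : ∀ x y, 0 ≤ w x y)
    (hl : 0 ≤ l) (hr : 0 ≤ r) (h : CorruptionBound w w' c l r)
    (h₀ : CorruptionBound w (fun _ _ => 0) c₀ l r) (p : Protocol X Y) :
    CorruptionBound w
      (fun x y => l * log 2 * (w x y * p.aliceBits x y) + r * log 2 * (w x y * p.bobBits x y) -
        if p.run x y then c * w x y - w' x y else c₀ * w x y) 0 l r := by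
  induction p with
  -- The induction is over all `f` and `g`, since these become the restrictions to the rectangle of
  -- a node. A leaf uses `h₀` or `h` according to its output.
  | output v =>
    intro f g hf hg
    cases v
    · have e := h₀ f g hf hg
      simp only [bil, Finset.mul_sum, Protocol.run, Protocol.aliceBits, Protocol.bobBits] at e ⊢
      simp only [neg_mul, zero_sub, Nat.cast_zero, mul_zero, add_zero, zero_mul,
        Finset.sum_const_zero, Finset.sum_neg_distrib, mul_assoc, Bool.false_eq_true,
        if_false] at e ⊢
      linarith
    · have e := h f g hf hg
      simp only [bil, Finset.mul_sum, Protocol.run, Protocol.aliceBits, Protocol.bobBits] at e ⊢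
      simp only [zero_sub, Nat.cast_zero, mul_zero, add_zero, zero_mul,
        Finset.sum_const_zero, mul_assoc, if_true, sub_mul, neg_sub,
        Finset.sum_sub_distrib] at e ⊢
      linarith
  | alice msg next ih =>
    intro f g hf hg
    have i₁ := ih true _ g (restrict_nonneg (msg := msg) hf true) hg
    have i₂ := ih false _ g (restrict_nonneg (msg := msg) hf false) hg
    have hs := bil_split (fun b x y => l * log 2 * (w x y * (next b).aliceBits x y) +
      r * log 2 * (w x y * (next b).bobBits x y) -
        if (next b).run x y then c * w x y - w' x y else c₀ * w x y) msg f g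
    have hA := mul_le_mul_of_nonneg_left (entA_split_le hw hf hg msg) hl
    have hB := entB_split w f g msg
    have hnode : bil (fun x y => l * log 2 * (w x y * (Protocol.alice msg next).aliceBits x y) +
        r * log 2 * (w x y * (Protocol.alice msg next).bobBits x y) -
        if (Protocol.alice msg next).run x y then c * w x y - w' x y else c₀ * w x y) f g =
        l * log 2 * bil w f g + bil (fun x y => l * log 2 * (w x y * (next (msg x)).aliceBits x y) +
      r * log 2 * (w x y * (next (msg x)).bobBits x y) -
        if (next (msg x)).run x y then c * w x y - w' x y else c₀ * w x y) f g := by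
      simp only [bil, Protocol.run, Protocol.aliceBits, Protocol.bobBits, Finset.mul_sum,
        ← Finset.sum_add_distrib]
      refine Finset.sum_congr rfl fun x _ => Finset.sum_congr rfl fun y _ => ?_
      push_cast
      ring_nf
    rw [hnode, hs, ← hB]
    linarith
  | bob msg next ih =>
    intro f g hf hg
    have i₁ := ih true f _ hf (restrict_nonneg (msg := msg) hg true)
    have i₂ := ih false f _ hf (restrict_nonneg (msg := msg) hg false)
    have hs := bil_split_right (fun b x y => l * log 2 * (w x y * (next b).aliceBits x y) +
      r * log 2 * (w x y * (next b).bobBits x y) -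
        if (next b).run x y then c * w x y - w' x y else c₀ * w x y) msg f g
    have hB := mul_le_mul_of_nonneg_left (entA_split_le (fun y x => hw x y) hg hf msg) hr
    have hA := entB_split (fun y x => w x y) g f msg
    rw [← bil_swap] at hB
    simp only [entB_eq_entA_swap] at hA i₁ i₂ ⊢
    have hnode : bil (fun x y => l * log 2 * (w x y * (Protocol.bob msg next).aliceBits x y) +
        r * log 2 * (w x y * (Protocol.bob msg next).bobBits x y) -
        if (Protocol.bob msg next).run x y then c * w x y - w' x y else c₀ * w x y) f g =
        r * log 2 * bil w f g + bil (fun x y => l * log 2 * (w x y * (next (msg y)).aliceBits x y) +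
      r * log 2 * (w x y * (next (msg y)).bobBits x y) -
        if (next (msg y)).run x y then c * w x y - w' x y else c₀ * w x y) f g := by
      simp only [bil, Protocol.run, Protocol.aliceBits, Protocol.bobBits, Finset.mul_sum,
        ← Finset.sum_add_distrib]
      refine Finset.sum_congr rfl fun x _ => Finset.sum_congr rfl fun y _ => ?_
      push_cast
      ring_nf
    rw [hnode, hs, ← hA]
    linarith

omit [Fintype Y] in
theorem sum_blockProd {w : X → Y → ℝ} {d : ℝ} (hd : ∀ y, ∑ x, w x y = d) (N : ℕ)
    (y : Fin N → Y) : ∑ x, blockProd w N x y = d ^ N := by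
  have := Finset.prod_univ_sum (fun _ : Fin N => (Finset.univ : Finset X)) fun i x => w x (y i)
  simp only [hd, Finset.prod_const, Finset.card_univ, Fintype.card_fin,
    Fintype.piFinset_univ] at this
  exact this.symm

/-- The corruption bound for a protocol on `N` independent blocks. -/
theorem protocol_corruption {w w' : X → Y → ℝ} {l r dX dY : ℝ} (hw : ∀ x y, 0 ≤ w x y)
    (hl : 0 ≤ l) (hr : 0 ≤ r) (hX : ∀ y, ∑ x, w x y = dX) (hY : ∀ x, ∑ y, w x y = dY)
    (h : CorruptionBound w w' (1 - l * log dX - r * log dY) l r) (N : ℕ)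
    (p : Protocol (Fin N → X) (Fin N → Y)) {a b : ℕ} (ha : ∀ x y, p.aliceBits x y ≤ a)
    (hb : ∀ x y, p.bobBits x y ≤ b) :
    ∑ x, ∑ y, (if p.run x y then N * blockProd w N x y - blockSum w w' N x y else 0) ≤
      log 2 * (l * a + r * b) * ∑ x, ∑ y, blockProd w N x y := by
  have hW : ∀ x y, 0 ≤ blockProd w N x y := fun x y => Finset.prod_nonneg fun i _ => hw _ _
  have hX' := sum_blockProd hX N
  have hY' : ∀ x, ∑ y, blockProd w N x y = dY ^ N :=
    sum_blockProd (w := fun y x => w x y) hY N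
  have hsum0 : blockSum w (fun _ _ => 0) N = fun _ _ => 0 := by
    funext x y
    refine Finset.sum_eq_zero fun k _ => Finset.prod_eq_zero (Finset.mem_univ k) ?_
    simp
  have key₀ := (corruptionBound_zero hw hl hr hX hY).pow hw N
  rw [hsum0] at key₀
  -- At the root both functions are constant. Their unnormalised informations are `-log (dX ^ N)`
  -- and `-log (dY ^ N)` times the total mass, which cancels the logarithms in the constants of `h`
  -- and `key₀`.
  have key := (h.pow hw N).protocol hW hl hr key₀ p (fun _ => 1) (fun _ => 1)
    (fun _ => zero_le_one) (fun _ => zero_le_one)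
  rw [entA_one hX', entB_one hY', log_pow, log_pow, zero_mul] at key
  have hle : bil (fun x y => l * log 2 * (blockProd w N x y * p.aliceBits x y) +
        r * log 2 * (blockProd w N x y * p.bobBits x y) -
        if p.run x y then N * (1 - l * log dX - r * log dY) * blockProd w N x y -
          blockSum w w' N x y else N * (-(l * log dX) - r * log dY) * blockProd w N x y)
        (fun _ => 1) (fun _ => 1) ≤
      bil (fun x y => (log 2 * (l * a + r * b) + N * (l * log dX + r * log dY)) *
        blockProd w N x y -
        if p.run x y then N * blockProd w N x y - blockSum w w' N x y else 0)
        (fun _ => 1) (fun _ => 1) := by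
    refine Finset.sum_le_sum fun x _ => Finset.sum_le_sum fun y _ => ?_
    have hA : l * log 2 * (blockProd w N x y * p.aliceBits x y) ≤
        l * log 2 * (blockProd w N x y * a) := by
      have : (p.aliceBits x y : ℝ) ≤ a := by exact_mod_cast ha x y
      have := log_nonneg (one_le_two (α := ℝ))
      have := hW x y
      gcongr
    have hB : r * log 2 * (blockProd w N x y * p.bobBits x y) ≤
        r * log 2 * (blockProd w N x y * b) := by
      have : (p.bobBits x y : ℝ) ≤ b := by exact_mod_cast hb x y
      have := log_nonneg (one_le_two (α := ℝ))
      have := hW x y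
      gcongr
    simp only [mul_one]
    split_ifs <;> linarith
  have heq : bil (fun x y => (log 2 * (l * a + r * b) + N * (l * log dX + r * log dY)) *
        blockProd w N x y -
        if p.run x y then N * blockProd w N x y - blockSum w w' N x y else 0)
        (fun _ => 1) (fun _ => 1) =
      (log 2 * (l * a + r * b) + N * (l * log dX + r * log dY)) *
        bil (blockProd w N) (fun _ => 1) (fun _ => 1) -
      ∑ x, ∑ y, (if p.run x y then N * blockProd w N x y - blockSum w w' N x y else 0) := by
    simp only [bil, mul_one, Finset.mul_sum, Finset.sum_sub_distrib]
  have hbil : bil (blockProd w N) (fun _ => 1) (fun _ => 1) = ∑ x, ∑ y, blockProd w N x y := by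
    simp only [bil, mul_one]
  rw [heq] at hle
  rw [hbil] at hle key
  linarith

end Entropy

end LSD

/-! ### The corruption bound for a single block -/

namespace LSD

open Real

section Block

variable {ι : Type}

/-- The indicator of disjointness in one block: `(i, c)` is element `c` of pair `i`, and `t i` is
the element of pair `i` that belongs to Bob's set. -/
def disjWeight (s : ι × Bool) (t : ι → Bool) : ℝ := if t s.1 = s.2 then 0 else 1

/-- The indicator of intersection in one block. -/
def interWeight (s : ι × Bool) (t : ι → Bool) : ℝ := if t s.1 = s.2 then 1 else 0

theorem disjWeight_nonneg (s : ι × Bool) (t : ι → Bool) : 0 ≤ disjWeight s t := by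
  unfold disjWeight; split_ifs <;> norm_num

theorem interWeight_nonneg (s : ι × Bool) (t : ι → Bool) : 0 ≤ interWeight s t := by
  unfold interWeight; split_ifs <;> norm_num

theorem disjWeight_add_interWeight (s : ι × Bool) (t : ι → Bool) :
    disjWeight s t + interWeight s t = 1 := by
  unfold disjWeight interWeight; split_ifs <;> norm_num

variable [Fintype ι]

theorem sum_disjWeight_left (t : ι → Bool) : ∑ s, disjWeight s t = Fintype.card ι := by
  have : ∀ i, ∑ c, disjWeight (i, c) t = 1 := fun i => by
    cases h : t i <;> simp [disjWeight, h]
  simp only [Fintype.sum_prod_type, this]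
  simp

variable [DecidableEq ι]

/-- An exponential moment under the sets that avoid an element. -/
theorem sum_disjWeight_mul_exp (s : ι × Bool) (c : ι → Bool) {J : Finset ι} (hs : s.1 ∉ J)
    (θ : ℝ) :
    ∑ t, disjWeight s t * exp (∑ i ∈ J, if t i = c i then 0 else θ) =
      2 ^ (Fintype.card ι - 1) * ((1 + exp θ) / 2) ^ J.card := by
  -- Given that Bob's set avoids `s`, his choices in the other pairs are still independent and
  -- uniform, so the moment factors. Pair `s.1` has one admissible choice, whence the exponent `card
  -- ι - 1`.
  let ψ : ι → Bool → ℝ := fun i b =>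
    (if i = s.1 then if b = s.2 then 0 else 1 else 1) *
      (if i ∈ J then if b = c i then 1 else exp θ else 1)
  have h1 : ∀ t : ι → Bool, disjWeight s t * exp (∑ i ∈ J, if t i = c i then 0 else θ) =
      ∏ i, ψ i (t i) := by
    intro t
    simp only [ψ, Finset.prod_mul_distrib, exp_sum, Finset.prod_ite_eq', Finset.mem_univ, if_true,
      Finset.prod_ite_mem, Finset.univ_inter, disjWeight]
    congr 1
    refine Finset.prod_congr rfl fun i _ => ?_
    split_ifs <;> simp
  have h2 : ∀ i, ∑ b, ψ i b = (if i = s.1 then 1 else 2) *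
      (if i ∈ J then (1 + exp θ) / 2 else 1) := by
    intro i
    by_cases hi : i = s.1
    · subst hi
      cases h : s.2 <;> simp [ψ, hs, h]
    · by_cases hJ : i ∈ J
      · cases h : c i <;> simp [ψ, hi, hJ, h] <;> ring
      · simp [ψ, hi, hJ]
  have h3 := Finset.prod_univ_sum (fun _ : ι => (Finset.univ : Finset Bool)) ψ
  rw [Fintype.piFinset_univ] at h3
  rw [Finset.sum_congr rfl fun t _ => h1 t, ← h3, Finset.prod_congr rfl fun i _ => h2 i,
    Finset.prod_mul_distrib, Finset.prod_ite_mem, Finset.univ_inter, Finset.prod_const,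
    Finset.prod_ite, Finset.prod_const_one, one_mul, Finset.prod_const, Finset.filter_ne',
    Finset.card_erase_of_mem (Finset.mem_univ _), Finset.card_univ]

theorem sum_disjWeight_right (s : ι × Bool) :
    ∑ t, disjWeight s t = 2 ^ (Fintype.card ι - 1) := by
  have := sum_disjWeight_mul_exp s (fun _ => false) (Finset.notMem_empty s.1) 0
  simpa using this

/-- If Bob's function carries little information, given that his set avoids `s`, then there are
few pairs with an element that is seldom in his set. -/
theorem exists_few_biased (s : ι × Bool) {g : (ι → Bool) → ℝ} (hg : ∀ t, 0 ≤ g t) :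
    ∃ J : Finset ι, s.1 ∉ J ∧
      J.card * (∑ t, disjWeight s t * g t) ≤
        40 * (∑ t, disjWeight s t * g t * (log (g t) - log (∑ t', disjWeight s t' * g t')) +
          (∑ t, disjWeight s t * g t) * log (2 ^ (Fintype.card ι - 1))) ∧
      ∀ u : ι × Bool, u.1 ≠ s.1 → u.1 ∉ J →
        (∑ t, disjWeight s t * g t) / 4 ≤ ∑ t, disjWeight s t * g t * interWeight u t := by
  classical
  set G := ∑ t, disjWeight s t * g t with hG
  have hG0 : 0 ≤ G := Finset.sum_nonneg fun t _ => mul_nonneg (disjWeight_nonneg _ _) (hg t)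
  let q : ι × Bool → ℝ := fun u => ∑ t, disjWeight s t * g t * interWeight u t
  let J : Finset ι := Finset.univ.filter fun i => i ≠ s.1 ∧ ∃ b, q (i, b) < G / 4
  have hc : ∀ i, ∃ b, i ∈ J → q (i, b) < G / 4 := by
    intro i
    by_cases hi : i ∈ J
    · obtain ⟨b, hb⟩ := (Finset.mem_filter.1 hi).2.2
      exact ⟨b, fun _ => hb⟩
    · exact ⟨true, fun h => absurd h hi⟩
  choose c hc using hc
  have hsJ : s.1 ∉ J := fun h => (Finset.mem_filter.1 h).2.1 rfl
  refine ⟨J, hsJ, ?_, ?_⟩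
  -- Each biased pair takes its likelier value with probability at least `3/4`, which gains `3/20`
  -- at tilt `1/5`. Its exponential moment costs at most `log ((1 + exp (1/5)) / 2) ≤ 1/8`. The
  -- difference `1/40` is the source of the factor `40`.
  · have key := gibbs_variational (fun t => disjWeight_nonneg s t) hg
      fun t => ∑ i ∈ J, if t i = c i then 0 else (1 / 5 : ℝ)
    rw [sum_disjWeight_mul_exp s c hsJ, ← hG] at key
    have hlow : J.card * (G * (3 / 20)) ≤
        ∑ t, disjWeight s t * g t * ∑ i ∈ J, if t i = c i then 0 else (1 / 5 : ℝ) := by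
      simp only [Finset.mul_sum]
      rw [Finset.sum_comm, ← nsmul_eq_mul]
      refine Finset.card_nsmul_le_sum _ _ _ fun i hi => ?_
      have h1 : ∑ t, disjWeight s t * g t * (if t i = c i then 0 else (1 / 5 : ℝ)) =
          (G - q (i, c i)) * (1 / 5) := by
        rw [hG, ← Finset.sum_sub_distrib, Finset.sum_mul]
        refine Finset.sum_congr rfl fun t _ => ?_
        simp only [interWeight]
        split_ifs <;> ring
      rw [h1]
      have := hc i hi
      linarith
    have he : exp (1 / 5 : ℝ) ≤ 5 / 4 := by
      have := exp_bound_div_one_sub_of_interval (x := 1 / 5) (by norm_num) (by norm_num)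
      norm_num at this ⊢
      linarith
    have hlog : log ((1 + exp (1 / 5 : ℝ)) / 2) ≤ 1 / 8 := by
      have := log_le_sub_one_of_pos (x := (1 + exp (1 / 5 : ℝ)) / 2) (by positivity)
      linarith
    rw [log_mul (by positivity) (by positivity), log_pow (_ / _)] at key
    have h2 : G * (J.card * log ((1 + exp (1 / 5 : ℝ)) / 2)) ≤ G * (J.card * (1 / 8)) := by
      gcongr
    linarith
  · intro u hu hJ
    by_contra! hlt
    exact hJ (Finset.mem_filter.2 ⟨Finset.mem_univ _, hu, u.2, hlt⟩)

/-- If Alice's function carries little information, then it gives little mass to few pairs. -/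
theorem small_mass_of_few {f : ι × Bool → ℝ} (hf : ∀ s, 0 ≤ f s) (t : ι → Bool) (I : Finset ι)
    {L : ℝ} (hL : exp L * I.card ≤ Fintype.card ι) (hn : 0 < Fintype.card ι) :
    L * ∑ s, disjWeight s t * f s * (if s.1 ∈ I then 1 else 0) ≤
      ∑ s, disjWeight s t * f s * (log (f s) - log (∑ s', disjWeight s' t * f s')) +
        (∑ s, disjWeight s t * f s) * (log (Fintype.card ι) + 1) := by
  -- Tilting by `L` on `I` raises the total weight from `n` to at most `exp L * |I| + n ≤ 2 n`; the
  -- `+ 1` in the conclusion absorbs `log 2`.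
  have key := gibbs_variational (fun s => disjWeight_nonneg s t) hf
    fun s => L * if s.1 ∈ I then 1 else 0
  have hn' : (0 : ℝ) < Fintype.card ι := by exact_mod_cast hn
  have hF : 0 ≤ ∑ s, disjWeight s t * f s :=
    Finset.sum_nonneg fun s _ => mul_nonneg (disjWeight_nonneg _ _) (hf s)
  have hE : ∑ s, disjWeight s t * exp (L * if s.1 ∈ I then 1 else 0) ≤
      2 * (Fintype.card ι : ℝ) := by
    have h1 : ∀ i, ∑ c, disjWeight (i, c) t * exp (L * if i ∈ I then 1 else 0) =
        exp (L * if i ∈ I then 1 else 0) := fun i => by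
      cases h : t i <;> simp [disjWeight, h]
    have h2 : ∀ i, exp (L * if i ∈ I then 1 else 0) ≤ (if i ∈ I then exp L else 0) + 1 :=
      fun i => by split_ifs <;> simp
    rw [Fintype.sum_prod_type]
    simp only [h1]
    refine (Finset.sum_le_sum fun i _ => h2 i).trans ?_
    rw [Finset.sum_add_distrib, Finset.sum_ite_mem, Finset.univ_inter]
    simp only [Finset.sum_const, nsmul_eq_mul, mul_one, Finset.card_univ]
    linarith
  have hEpos : 0 < ∑ s, disjWeight s t * exp (L * if s.1 ∈ I then 1 else 0) := by
    obtain ⟨i⟩ := Fintype.card_pos_iff.1 hn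
    refine Finset.sum_pos' (fun s _ => mul_nonneg (disjWeight_nonneg _ _) (exp_pos _).le)
      ⟨(i, !t i), Finset.mem_univ _, ?_⟩
    simp [disjWeight, exp_pos]
  have hlog := log_le_log hEpos hE
  rw [log_mul two_ne_zero hn'.ne'] at hlog
  have hlog2 := log_le_sub_one_of_pos (two_pos (α := ℝ))
  have : log (∑ s, disjWeight s t * exp (L * if s.1 ∈ I then 1 else 0)) ≤
      log (Fintype.card ι) + 1 := by linarith
  have := mul_le_mul_of_nonneg_left this hF
  have hl : ∑ s, disjWeight s t * f s * (L * if s.1 ∈ I then 1 else 0) =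
      L * ∑ s, disjWeight s t * f s * (if s.1 ∈ I then 1 else 0) := by
    rw [Finset.mul_sum]
    exact Finset.sum_congr rfl fun s _ => by ring
  rw [hl] at key
  linarith

/-- The corruption bound for one block. -/
theorem block_corruption {A Q : ℝ} (hA : 0 < A) (hQ : 0 < Q)
    (hn : exp (3 * (A + 1)) * (92 * Q + 1) ≤ Fintype.card ι) :
    CorruptionBound (disjWeight (ι := ι)) (fun s t => 16 * interWeight s t)
      (1 - A⁻¹ * log (Fintype.card ι) - Q⁻¹ * log (2 ^ (Fintype.card ι - 1))) A⁻¹ Q⁻¹ := by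
  classical
  intro f g hf hg
  have hcard : 0 < Fintype.card ι := by
    have : (0 : ℝ) < Fintype.card ι := lt_of_lt_of_le (by positivity) hn
    exact_mod_cast this
  set Z := bil (disjWeight (ι := ι)) f g with hZ
  set Z' := bil (interWeight (ι := ι)) f g with hZ'
  have h16 : bil (fun (s : ι × Bool) t => 16 * interWeight s t) f g = 16 * Z' := by
    simp only [hZ', bil, Finset.mul_sum, mul_assoc]
  rw [h16]
  set F := ∑ s, f s with hF
  set G := ∑ t, g t with hG
  have hFG : F * G = Z + Z' := by
    rw [hZ, hZ', ← bil_add_weight]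
    simp only [disjWeight_add_interWeight, bil, one_mul, hF, hG, Finset.sum_mul_sum]
  have eA0 := entA_add_nonneg disjWeight_nonneg (sum_disjWeight_left (ι := ι)) hf hg
  have eB0 := entB_add_nonneg disjWeight_nonneg (sum_disjWeight_right (ι := ι)) hf hg
  rw [← hZ] at eA0 eB0
  have hZ'0 : 0 ≤ Z' := Finset.sum_nonneg fun s _ => Finset.sum_nonneg fun t _ =>
    mul_nonneg (interWeight_nonneg _ _) (mul_nonneg (hf _) (hg _))
  have hF0 : 0 ≤ F := Finset.sum_nonneg fun s _ => hf s
  have hG0 : 0 ≤ G := Finset.sum_nonneg fun s _ => hg s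
  by_contra! hcon
  -- These are the normalised, nonnegative informations. The negated claim reads `16 Z' + eA / A +
  -- eB / Q < Z`, so each of the three terms is less than `Z`.
  set eA := entA disjWeight f g + log (Fintype.card ι) * Z with heA
  set eB := entB disjWeight f g + log (2 ^ (Fintype.card ι - 1)) * Z with heB
  have hsum : 16 * Z' + A⁻¹ * eA + Q⁻¹ * eB < Z := by
    rw [heA, heB]; linarith
  have hAe : 0 ≤ A⁻¹ * eA := by positivity
  have hQe : 0 ≤ Q⁻¹ * eB := by positivity
  have hZ'lt : 16 * Z' < Z := by linarith
  have hZpos : 0 < Z := by linarith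
  have hFGpos : 0 < F * G := by linarith
  have hFpos : 0 < F := hF0.lt_of_ne fun h => by simp [← h] at hFGpos
  have hGpos : 0 < G := hG0.lt_of_ne fun h => by simp [← h] at hFGpos
  have heAlt : eA < A * Z := by
    have : A⁻¹ * eA < Z := by linarith
    rwa [inv_mul_lt_iff₀ hA] at this
  have heBlt : eB < Q * Z := by
    have : Q⁻¹ * eB < Z := by linarith
    rwa [inv_mul_lt_iff₀ hQ] at this
  -- a good reference element for Alice
  let κ : ι × Bool → ℝ := fun s =>
    ∑ t, disjWeight s t * g t * (log (g t) - log (∑ t', disjWeight s t' * g t')) +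
      (∑ t, disjWeight s t * g t) * log (2 ^ (Fintype.card ι - 1))
  have hκ0 : ∀ s, 0 ≤ κ s := fun s => by
    have := entropy_nonneg (fun t => disjWeight_nonneg s t) hg
    rwa [sum_disjWeight_right] at this
  have hκ : ∑ s, f s * κ s = eB := by
    simp only [κ, heB, hZ, entB_eq_sum, bil_eq_sum_left, mul_add, Finset.sum_add_distrib,
      ← mul_assoc, ← Finset.sum_mul]
    rw [mul_comm (log _)]
  -- Averaging over `f`: the left sum is `16 Q Z' + eB < 2 Q Z`, while the right one is `2 Q (Z +
  -- Z')`. The chosen `s` is rarely in Bob's set, and avoiding it reveals little about that set.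
  obtain ⟨s, -, hs⟩ := Finset.exists_lt_of_sum_lt (s := Finset.univ)
    (f := fun s => f s * (16 * Q * (∑ t, interWeight s t * g t) + κ s))
    (g := fun s => f s * (2 * Q * G)) (by
      rw [← Finset.sum_mul]
      have : ∑ s, f s * (16 * Q * (∑ t, interWeight s t * g t) + κ s) = 16 * Q * Z' + eB := by
        simp only [mul_add, Finset.sum_add_distrib, hκ, hZ', bil_eq_sum_left,
          mul_left_comm (f _), ← Finset.mul_sum]
      have h1 := mul_lt_mul_of_pos_left hZ'lt hQ
      have h2 := mul_nonneg hQ.le hZ'0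
      rw [this, ← hF, show F * (2 * Q * G) = 2 * Q * (F * G) by ring, hFG]
      linarith)
  have hs' := lt_of_mul_lt_mul_left hs (hf s)
  set G₁ := ∑ t, disjWeight s t * g t with hG₁
  set G₂ := ∑ t, interWeight s t * g t with hG₂
  have hG₂0 : 0 ≤ G₂ := Finset.sum_nonneg fun t _ => mul_nonneg (interWeight_nonneg _ _) (hg t)
  have hG12 : G₁ + G₂ = G := by
    rw [hG₁, hG₂, ← Finset.sum_add_distrib, hG]
    exact Finset.sum_congr rfl fun t _ => by rw [← add_mul, disjWeight_add_interWeight, one_mul]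
  have hG₂lt : G₂ < G / 8 := by
    have := hκ0 s
    have : Q * (16 * G₂) < Q * (2 * G) := by linarith
    have := lt_of_mul_lt_mul_left this hQ.le
    linarith
  have hκlt : κ s < 2 * Q * G := by
    have : 0 ≤ 16 * Q * G₂ := by positivity
    linarith
  obtain ⟨J, hsJ, hJ, hgood⟩ := exists_few_biased s hg
  rw [← hG₁] at hJ hgood
  have hJκ : J.card * G₁ ≤ 40 * κ s := hJ
  -- `|J| G₁ ≤ 40 κ s < 80 Q G` and `G₁ > 7/8 G`; the constant works because `92 * 7/8 > 80`.
  have hJcard : (J.card : ℝ) ≤ 92 * Q := by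
    by_contra! hlt
    have h1 : 92 * Q * G₁ ≤ J.card * G₁ := by
      have : 0 ≤ G₁ := by linarith
      gcongr
    have h2 : Q * (92 * G₁) < Q * (80 * G) := by linarith
    have := lt_of_mul_lt_mul_left h2 hQ.le
    linarith
  -- Alice seldom hits a pair that is biased for Bob
  set I := insert s.1 J with hI
  have hIcard : (I.card : ℝ) ≤ 92 * Q + 1 := by
    rw [hI, Finset.card_insert_of_notMem hsJ]
    push_cast
    linarith
  have hL : exp (3 * (A + 1)) * I.card ≤ Fintype.card ι :=
    (mul_le_mul_of_nonneg_left hIcard (exp_pos _).le).trans hn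
  have hbad := Finset.sum_le_sum fun t (_ : t ∈ Finset.univ) =>
    mul_le_mul_of_nonneg_left (small_mass_of_few hf t I hL hcard) (hg t)
  have hbad' : 3 * (A + 1) * bil disjWeight (fun s => f s * if s.1 ∈ I then 1 else 0) g ≤
      eA + Z := by
    have e1 : ∑ t, g t * (3 * (A + 1) *
          ∑ s, disjWeight s t * f s * (if s.1 ∈ I then 1 else 0)) =
        3 * (A + 1) * bil disjWeight (fun s => f s * if s.1 ∈ I then 1 else 0) g := by
      rw [bil_eq_sum_right, Finset.mul_sum]
      refine Finset.sum_congr rfl fun t _ => ?_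
      simp only [mul_assoc]
      ring
    have e2 : ∑ t, g t * (∑ s, disjWeight s t * f s *
          (log (f s) - log (∑ s', disjWeight s' t * f s')) +
        (∑ s, disjWeight s t * f s) * (log (Fintype.card ι) + 1)) = eA + Z := by
      rw [heA, hZ, entA_eq_sum, bil_eq_sum_right, Finset.mul_sum, ← Finset.sum_add_distrib,
        ← Finset.sum_add_distrib]
      exact Finset.sum_congr rfl fun t _ => by ring
    rw [← e1, ← e2]
    exact hbad
  set M := bil disjWeight (fun s => f s * if s.1 ∈ I then 1 else 0) g with hM
  have hM3 : M ≤ Z / 3 := by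
    have : (A + 1) * (3 * M) ≤ (A + 1) * Z := by linarith
    have := le_of_mul_le_mul_left this (by positivity)
    linarith
  have hM' : bil interWeight (fun s => f s * if s.1 ∈ I then 1 else 0) g ≤ Z' := by
    refine Finset.sum_le_sum fun s _ => Finset.sum_le_sum fun t _ => ?_
    refine mul_le_mul_of_nonneg_left (mul_le_mul_of_nonneg_right ?_ (hg t))
      (interWeight_nonneg _ _)
    dsimp only
    split_ifs
    · rw [mul_one]
    · rw [mul_zero]; exact hf s
  have hFI : (∑ s, f s * if s.1 ∈ I then 1 else 0) * G ≤ Z / 3 + Z' := by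
    have : (∑ s, f s * if s.1 ∈ I then 1 else 0) * G =
        M + bil interWeight (fun s => f s * if s.1 ∈ I then 1 else 0) g := by
      rw [hM, ← bil_add_weight]
      simp only [disjWeight_add_interWeight, bil, one_mul, hG, Finset.sum_mul_sum]
    linarith
  -- the other elements are often in Bob's set
  have hlow : (F - ∑ s, f s * if s.1 ∈ I then 1 else 0) * (G₁ / 4) ≤ Z' := by
    rw [hF, ← Finset.sum_sub_distrib, Finset.sum_mul, hZ', bil_eq_sum_left]
    refine Finset.sum_le_sum fun u _ => ?_
    have hnn : 0 ≤ ∑ t, interWeight u t * g t :=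
      Finset.sum_nonneg fun t _ => mul_nonneg (interWeight_nonneg _ _) (hg t)
    split_ifs with hu
    · have := mul_nonneg (hf u) hnn
      linarith
    · rw [hI, Finset.mem_insert, not_or] at hu
      rw [mul_zero, sub_zero]
      refine mul_le_mul_of_nonneg_left ((hgood u hu.1 hu.2).trans ?_) (hf u)
      refine Finset.sum_le_sum fun t _ => ?_
      have h1 : disjWeight s t ≤ 1 := by
        have := disjWeight_add_interWeight s t
        have := interWeight_nonneg s t
        linarith
      have h2 := mul_nonneg (hg t) (interWeight_nonneg u t)
      have h3 := mul_le_mul_of_nonneg_right h1 h2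
      linarith
  have hlow2 : (F - ∑ s, f s * if s.1 ∈ I then 1 else 0) * G * (7 / 32) ≤
      (F - ∑ s, f s * if s.1 ∈ I then 1 else 0) * (G₁ / 4) := by
    have h1 : G * (7 / 32) ≤ G₁ / 4 := by linarith
    have h2 : 0 ≤ F - ∑ s, f s * if s.1 ∈ I then 1 else 0 := by
      rw [hF, ← Finset.sum_sub_distrib]
      refine Finset.sum_nonneg fun u _ => ?_
      have := hf u
      split_ifs <;> linarith
    have := mul_le_mul_of_nonneg_left h1 h2
    linarith
  -- Outside `I` the product mass is at least `(Z + Z') - (Z/3 + Z') = 2Z/3`, so `Z' ≥ (7/32) (2/3)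
  -- Z = (7/48) Z`, contradicting `16 Z' < Z`.
  rw [sub_mul] at hlow2
  linarith

end Block

end LSD

/-! ### Expectations and fixing the coins -/

namespace PMF

variable {α β : Type}

/-- The expectation of a nonnegative function. -/
noncomputable def mean (q : PMF α) (e : α → ℝ≥0∞) : ℝ≥0∞ := ∑' x, q x * e x

theorem mean_bind (q : PMF α) (k : α → PMF β) (e : β → ℝ≥0∞) :
    (q.bind k).mean e = q.mean fun x => (k x).mean e := by
  simp only [mean, bind_apply, ← ENNReal.tsum_mul_right, ← ENNReal.tsum_mul_left]
  rw [ENNReal.tsum_comm]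
  simp only [mul_assoc]

theorem mean_pure (x : α) (e : α → ℝ≥0∞) : (PMF.pure x).mean e = e x := by
  rw [mean, tsum_eq_single x fun y hy => by simp [hy]]
  simp

theorem mean_map (q : PMF α) (h : α → β) (e : β → ℝ≥0∞) :
    (q.map h).mean e = q.mean fun x => e (h x) := by
  rw [PMF.map, mean_bind]
  simp [mean_pure]

theorem mean_const (q : PMF α) (c : ℝ≥0∞) : q.mean (fun _ => c) = c := by
  simp [mean, ENNReal.tsum_mul_right]

theorem mean_comm (q : PMF α) (q' : PMF β) (e : α → β → ℝ≥0∞) :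
    q.mean (fun x => q'.mean fun y => e x y) = q'.mean fun y => q.mean fun x => e x y := by
  simp only [mean, ← ENNReal.tsum_mul_left]
  rw [ENNReal.tsum_comm]
  simp only [mul_left_comm]

/-- The point is taken in the support because the communication bounds hold only there. -/
theorem exists_le_mean (q : PMF α) (e : α → ℝ≥0∞) : ∃ x ∈ q.support, e x ≤ q.mean e := by
  by_contra! h
  obtain ⟨x₀, hx₀⟩ := q.support_nonempty
  have hfin : q.mean e ≠ ∞ := (h x₀ hx₀).ne_top
  have : q.mean (fun _ => q.mean e) < q.mean e := by
    refine ENNReal.tsum_lt_tsum (i := x₀) ?_ (fun x => ?_) ?_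
    · change q.mean (fun _ => q.mean e) ≠ ∞
      rwa [mean_const]
    · by_cases hx : x ∈ q.support
      · exact mul_le_mul_right (h x hx).le _
      · simp [(PMF.apply_eq_zero_iff q x).2 hx]
    · exact ENNReal.mul_lt_mul_right ((PMF.mem_support_iff q x₀).1 hx₀) (q.apply_ne_top x₀)
        (h x₀ hx₀)
  rw [mean_const] at this
  exact lt_irrefl _ this

theorem mean_uniformOfFinset (s : Finset α) (hs : s.Nonempty) (e : α → ℝ≥0∞) :
    (uniformOfFinset s hs).mean e = (s.card : ℝ≥0∞)⁻¹ * ∑ x ∈ s, e x := by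
  rw [mean, tsum_eq_sum (s := s) fun x hx => by simp [hx], Finset.mul_sum]
  exact Finset.sum_congr rfl fun x hx => by simp [hx]

theorem mean_uniformOfFintype [Fintype α] [Nonempty α] (e : α → ℝ≥0∞) :
    (uniformOfFintype α).mean e = (Fintype.card α : ℝ≥0∞)⁻¹ * ∑ x, e x := by
  rw [uniformOfFintype, mean_uniformOfFinset, Finset.card_univ]

end PMF

namespace RandProtocol

variable {X Y : Type}

theorem errorProb_eq_mean (P : RandProtocol X Y) (f : X → Y → Bool) (x : X) (y : Y) :
    P.errorProb f x y = P.mean fun p => if p.run x y = f x y then 0 else 1 := by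
  rw [errorProb, PMF.toOuterMeasure_apply, PMF.mean]
  refine tsum_congr fun p => ?_
  by_cases h : p.run x y = f x y <;> simp [Set.indicator, h]

/-- Some deterministic protocol in the support does as well as the randomized one. -/
theorem exists_deterministic (P : RandProtocol X Y) (f : X → Y → Bool) (D : PMF (X × Y)) :
    ∃ p ∈ P.support, D.mean (fun z => if p.run z.1 z.2 = f z.1 z.2 then 0 else 1) ≤
      P.distError f D := by
  have h : P.distError f D =
      P.mean fun p => D.mean fun z => if p.run z.1 z.2 = f z.1 z.2 then 0 else 1 := by
    rw [← PMF.mean_comm]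
    simp only [← errorProb_eq_mean]
    rfl
  rw [h]
  exact PMF.exists_le_mean P _

end RandProtocol

/-! ### The hard distribution in terms of block weights -/

namespace LSD

open Real

section Bridge

variable {p : ℕ}

/-- The elements of a block with `p` pairs. -/
def blockEquiv (p : ℕ) : Fin p × Bool ≃ Fin (p * 2) :=
  (Equiv.prodCongr (Equiv.refl _) finTwoEquiv.symm).trans finProdFinEquiv

theorem blockEquiv_val (k : Fin p) (c : Bool) :
    (blockEquiv p (k, c) : ℕ) = c.toNat + 2 * k := by
  cases c <;> simp [blockEquiv, finTwoEquiv]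

/-- The set of the chosen elements of the pairs. -/
def chosenSet (t : Fin p → Bool) : Finset (Fin (p * 2)) :=
  Finset.univ.image fun k => blockEquiv p (k, t k)

theorem blockEquiv_mem_chosenSet (s : Fin p × Bool) (t : Fin p → Bool) :
    blockEquiv p s ∈ chosenSet t ↔ t s.1 = s.2 := by
  simp only [chosenSet, Finset.mem_image, Finset.mem_univ, true_and, EmbeddingLike.apply_eq_iff_eq]
  constructor
  · rintro ⟨k, rfl⟩
    rfl
  · intro h
    exact ⟨s.1, by rw [h]⟩

theorem chosenSet_injective : Function.Injective (chosenSet (p := p)) := by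
  intro t t' h
  funext k
  have := (blockEquiv_mem_chosenSet (k, t k) t).2 rfl
  rw [h] at this
  exact ((blockEquiv_mem_chosenSet (k, t k) t').1 this).symm

theorem mem_bobBlocks_iff (t : Finset (Fin (p * 2))) :
    t ∈ bobBlocks (p * 2) ↔ ∀ k, Xor (blockEquiv p (k, false) ∈ t) (blockEquiv p (k, true) ∈ t) := by
  simp only [bobBlocks, Finset.mem_filter, Finset.mem_univ, true_and]
  constructor
  · intro h k
    exact h _ _ (by simp [blockEquiv_val]) (by simp [blockEquiv_val, add_comm])
  · intro h j j' hj hj'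
    obtain ⟨⟨k, c⟩, rfl⟩ := (blockEquiv p).surjective j
    obtain ⟨⟨k', c'⟩, rfl⟩ := (blockEquiv p).surjective j'
    rw [blockEquiv_val] at hj
    simp only [blockEquiv_val] at hj'
    cases c
    · cases c'
      · simp at hj'; omega
      · obtain rfl : k' = k := Fin.ext (by simp at hj'; omega)
        exact h k'
    · rw [Nat.even_iff] at hj
      simp at hj

theorem mem_bobBlocks_iff_exists (t : Finset (Fin (p * 2))) :
    t ∈ bobBlocks (p * 2) ↔ ∃ u, chosenSet u = t := by
  rw [mem_bobBlocks_iff]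
  constructor
  · intro h
    refine ⟨fun k => decide (blockEquiv p (k, true) ∈ t), ?_⟩
    ext j
    obtain ⟨⟨k, c⟩, rfl⟩ := (blockEquiv p).surjective j
    rw [blockEquiv_mem_chosenSet]
    have := h k
    rw [xor_iff_not_iff] at this
    cases c
    · simp
      tauto
    · simp
  · rintro ⟨u, rfl⟩ k
    rw [blockEquiv_mem_chosenSet, blockEquiv_mem_chosenSet]
    cases h : u k <;> simp [Xor]

variable {N : ℕ}

/-- The choices that belong to a pair of block-wise inputs. -/
def toChoices (z : (Fin N → Fin p × Bool) × (Fin N → Fin p → Bool)) (i : Fin N) :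
    Fin (p * 2) × Finset (Fin (p * 2)) :=
  (blockEquiv p (z.1 i), chosenSet (z.2 i))

theorem toChoices_injective : Function.Injective (toChoices (p := p) (N := N)) := by
  intro z z' h
  refine Prod.ext (funext fun i => ?_) (funext fun i => ?_)
  · exact (blockEquiv p).injective (congrArg Prod.fst (congrFun h i))
  · exact chosenSet_injective (congrArg Prod.snd (congrFun h i))

theorem toChoices_mem_hardChoices (z : (Fin N → Fin p × Bool) × (Fin N → Fin p → Bool))
    (k : Fin N) :
    toChoices z ∈ hardChoices N (p * 2) k ↔ ∀ i, i = k ∨ z.2 i (z.1 i).1 ≠ (z.1 i).2 := by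
  have hb : ∀ i, chosenSet (z.2 i) ∈ bobBlocks (p * 2) := fun i =>
    (mem_bobBlocks_iff_exists _).2 ⟨_, rfl⟩
  rw [hardChoices, Fintype.mem_piFinset]
  refine forall_congr' fun i => ?_
  by_cases hi : i = k <;>
    simp [hi, blockPairs, disjBlockPairs, toChoices, hb, blockEquiv_mem_chosenSet]

theorem exists_toChoices {k : Fin N} {w : Fin N → Fin (p * 2) × Finset (Fin (p * 2))}
    (hw : w ∈ hardChoices N (p * 2) k) : ∃ z, toChoices z = w := by
  rw [hardChoices, Fintype.mem_piFinset] at hw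
  have hb : ∀ i, (w i).2 ∈ bobBlocks (p * 2) := fun i => by
    have := hw i
    split_ifs at this
    · exact (Finset.mem_product.1 this).2
    · exact (Finset.mem_product.1 (Finset.mem_filter.1 this).1).2
  choose u hu using fun i => (mem_bobBlocks_iff_exists _).1 (hb i)
  refine ⟨(fun i => (blockEquiv p).symm (w i).1, u), funext fun i => ?_⟩
  simp [toChoices, hu]

/-- `toChoices` is injective and its image contains `hardChoices`; the product of weights is the
indicator of the preimage. -/
theorem sum_hardChoices (k : Fin N)
    (e : (Fin N → Fin (p * 2) × Finset (Fin (p * 2))) → ℝ) :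
    ∑ w ∈ hardChoices N (p * 2) k, e w =
      ∑ x, ∑ y, (∏ i, if i = k then 1 else disjWeight (x i) (y i)) * e (toChoices (x, y)) := by
  classical
  rw [← Fintype.sum_prod_type' (f := fun x y =>
    (∏ i, if i = k then 1 else disjWeight (x i) (y i)) * e (toChoices (x, y)))]
  rw [← Finset.univ_inter (hardChoices N (p * 2) k), ← Finset.sum_ite_mem]
  symm
  refine Fintype.sum_of_injective _ toChoices_injective _ _ (fun w hw => ?_) (fun z => ?_)
  · exact if_neg fun h => hw (exists_toChoices h)
  · have h1 : (∏ i, if i = k then 1 else disjWeight (z.1 i) (z.2 i)) =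
        if ∀ i, i = k ∨ z.2 i (z.1 i).1 ≠ (z.1 i).2 then 1 else 0 := by
      have := Finset.prod_ite_zero (s := Finset.univ) (f := fun _ : Fin N => (1 : ℝ))
        (p := fun i => i = k ∨ z.2 i (z.1 i).1 ≠ (z.1 i).2)
      simp only [Finset.mem_univ, true_imp_iff, Finset.prod_const_one] at this
      rw [← this]
      refine Finset.prod_congr rfl fun i _ => ?_
      by_cases hi : i = k <;> simp [hi, disjWeight]
    rw [h1]
    simp only [toChoices_mem_hardChoices]
    split_ifs <;> simp

theorem disj_toChoices (z : (Fin N → Fin p × Bool) × (Fin N → Fin p → Bool)) :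
    disj N (p * 2) (assembleAlice (toChoices z)) (assembleBob (toChoices z)) = true ↔
      ∀ i, z.2 i (z.1 i).1 ≠ (z.1 i).2 := by
  have hmem : ∀ i j, elt i j ∈ assembleBob (toChoices z) ↔ j ∈ chosenSet (z.2 i) := by
    intro i j
    simp only [assembleBob, elt, Finset.mem_biUnion, Finset.mem_univ, true_and, Finset.mem_image,
      EmbeddingLike.apply_eq_iff_eq, Prod.mk.injEq, toChoices]
    constructor
    · rintro ⟨i', j', h, rfl, rfl⟩
      exact h
    · intro h
      exact ⟨i, j, h, rfl, rfl⟩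
  rw [disj, decide_eq_true_iff, Finset.disjoint_left]
  simp only [assembleAlice, Finset.mem_image, Finset.mem_univ, true_and, forall_exists_index,
    forall_apply_eq_imp_iff, hmem, toChoices, blockEquiv_mem_chosenSet, ne_eq]

theorem prod_ite_eq_mul_erase {f g : Fin N → ℝ} (k : Fin N) :
    (∏ i, if i = k then f i else g i) = f k * ∏ i ∈ Finset.univ.erase k, g i := by
  rw [← Finset.mul_prod_erase _ _ (Finset.mem_univ k), if_pos rfl]
  congr 1
  exact Finset.prod_congr rfl fun i hi => if_neg (Finset.ne_of_mem_erase hi)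

/-- The unconstrained block `k` either is disjoint or intersects. Summed over `k`, this gives `N *
blockProd` plus `blockSum`, the two masses that the corruption bound compares. -/
theorem prod_one_eq_add (x : Fin N → Fin p × Bool) (y : Fin N → Fin p → Bool) (k : Fin N) :
    (∏ i, if i = k then 1 else disjWeight (x i) (y i)) = blockProd disjWeight N x y +
      ∏ i, if i = k then interWeight (x i) (y i) else disjWeight (x i) (y i) := by
  rw [prod_ite_eq_mul_erase (f := fun _ => 1), prod_ite_eq_mul_erase (f := fun i => interWeight _ _),
    blockProd, ← Finset.mul_prod_erase _ _ (Finset.mem_univ k), ← add_mul,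
    disjWeight_add_interWeight]

/-- Exactly half of Bob's sets in block `k` avoid Alice's element, so a hard input is disjoint with
probability `1/2`. -/
theorem card_hardChoices (k : Fin N) : ((hardChoices N (p * 2) k).card : ℝ) =
    2 * ∑ x, ∑ y, blockProd (disjWeight (ι := Fin p)) N x y := by
  have h := sum_hardChoices (p := p) k fun _ => 1
  simp only [Finset.sum_const, nsmul_eq_mul, mul_one] at h
  rw [h, Finset.mul_sum]
  refine Finset.sum_congr rfl fun x _ => ?_
  -- Alice's element in block `k` shows `p ≥ 1`, so the truncated subtraction in `2 ^ (p - 1)` is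
  -- harmless.
  have hp : p = p - 1 + 1 := (Nat.sub_add_cancel (x k).1.pos).symm
  have h1 := Finset.prod_univ_sum (fun _ : Fin N => (Finset.univ : Finset (Fin p → Bool)))
    fun i t => if i = k then 1 else disjWeight (x i) t
  have h2 : ∀ i, (∑ t, if i = k then 1 else disjWeight (x i) t) =
      if i = k then (2 : ℝ) ^ p else 2 ^ (p - 1) := fun i => by
    split_ifs
    · simp
    · simpa using sum_disjWeight_right (x i)
  have h3 := Finset.prod_univ_sum (fun _ : Fin N => (Finset.univ : Finset (Fin p → Bool)))
    fun i t => disjWeight (x i) t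
  rw [Fintype.piFinset_univ] at h1 h3
  simp only [blockProd]
  rw [← h1, ← h3, Finset.prod_congr rfl fun i _ => h2 i, prod_ite_eq_mul_erase,
    ← Finset.mul_prod_erase _ _ (Finset.mem_univ k)]
  simp only [sum_disjWeight_right, Fintype.card_fin, ← mul_assoc]
  congr 1
  conv_lhs => rw [hp]
  rw [pow_succ, mul_comm]

/-- The number of wrong answers on the hard inputs. -/
theorem sum_wrong (q : Protocol (AliceInput N (p * 2)) (BobInput N (p * 2)))
    (q' : Protocol (Fin N → Fin p × Bool) (Fin N → Fin p → Bool))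
    (hq : ∀ x y, q'.run x y =
      q.run (assembleAlice (toChoices (x, y))) (assembleBob (toChoices (x, y)))) :
    ∑ k, ∑ w ∈ hardChoices N (p * 2) k, (if q.run (assembleAlice w) (assembleBob w) =
        disj N (p * 2) (assembleAlice w) (assembleBob w) then (0 : ℝ) else 1) =
      ∑ x, ∑ y, if q'.run x y then blockSum disjWeight interWeight N x y
        else N * blockProd disjWeight N x y := by
  simp only [sum_hardChoices]
  rw [Finset.sum_comm]
  refine Finset.sum_congr rfl fun x _ => ?_
  rw [Finset.sum_comm]
  refine Finset.sum_congr rfl fun y _ => ?_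
  rw [← Finset.sum_mul, ← hq]
  simp only [prod_one_eq_add, Finset.sum_add_distrib, Finset.sum_const, Finset.card_univ,
    Fintype.card_fin, nsmul_eq_mul]
  change (_ + blockSum disjWeight interWeight N x y) * _ = _
  by_cases hd : ∀ i, y i (x i).1 ≠ (x i).2
  · have h0 : blockSum disjWeight interWeight N x y = 0 :=
      Finset.sum_eq_zero fun k _ => Finset.prod_eq_zero (Finset.mem_univ k) <| by
        simp [interWeight, hd k]
    rw [(disj_toChoices (x, y)).2 hd, h0]
    split_ifs <;> simp
  · have h0 : blockProd disjWeight N x y = 0 := by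
      push Not at hd
      obtain ⟨k, hk⟩ := hd
      exact Finset.prod_eq_zero (Finset.mem_univ k) (by simp [disjWeight, hk])
    have h1 : disj N (p * 2) (assembleAlice (toChoices (x, y)))
        (assembleBob (toChoices (x, y))) = false := by
      rw [← Bool.not_eq_true, disj_toChoices]
      exact hd
    rw [h1, h0]
    cases q'.run x y <;> simp

theorem mean_hardMixture [NeZero N] [NeZero (p * 2)]
    (e : AliceInput N (p * 2) × BobInput N (p * 2) → ℝ≥0∞) :
    (hardMixture N (p * 2)).mean e = (N : ℝ≥0∞)⁻¹ * ∑ k,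
      ((hardChoices N (p * 2) k).card : ℝ≥0∞)⁻¹ *
        ∑ w ∈ hardChoices N (p * 2) k, e (assembleAlice w, assembleBob w) := by
  simp only [hardMixture, hardDist, PMF.mean_bind, PMF.mean_map, PMF.mean_uniformOfFinset,
    PMF.mean_uniformOfFintype, Fintype.card_fin]

/-- The trade-off between the communication of Alice and of Bob, with explicit parameters. -/
theorem communication_tradeoff [NeZero N] [NeZero (p * 2)] {A Q : ℝ} (hA : 0 < A) (hQ : 0 < Q)
    (hp : exp (3 * (A + 1)) * (92 * Q + 1) ≤ p)
    (P : RandProtocol (AliceInput N (p * 2)) (BobInput N (p * 2))) {a b : ℕ}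
    (ha : P.AliceSendsAtMost a) (hb : P.BobSendsAtMost b)
    (hP : P.distError (disj N (p * 2)) (hardMixture N (p * 2)) < 1 / 9999) :
    N * A ≤ 4 * a ∨ N * Q ≤ 4 * b := by
  obtain ⟨q, hq, hqP⟩ := P.exists_deterministic (disj N (p * 2)) (hardMixture N (p * 2))
  have herr := hqP.trans_lt hP
  have hB : 0 < p * 2 := Nat.pos_of_ne_zero (NeZero.ne _)
  let q' : Protocol (Fin N → Fin p × Bool) (Fin N → Fin p → Bool) :=
    q.comap (fun x => assembleAlice fun i => (blockEquiv p (x i), ∅))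
      (fun y => assembleBob fun i => (⟨0, hB⟩, chosenSet (y i)))
  have hrun : ∀ x y, q'.run x y =
      q.run (assembleAlice (toChoices (x, y))) (assembleBob (toChoices (x, y))) :=
    fun x y => Protocol.run_comap _ _ _ _ _
  have hNpos : (0 : ℝ) < N := by exact_mod_cast Nat.pos_of_ne_zero (NeZero.ne N)
  set T := ∑ x, ∑ y, blockProd (disjWeight (ι := Fin p)) N x y with hT
  have hTpos : 0 < T := by
    have h1 : 0 < (hardChoices N (p * 2) 0).card := (hardChoices_nonempty N (p * 2) 0).card_pos
    have h2 := card_hardChoices (p := p) (0 : Fin N)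
    have h3 : (0 : ℝ) < (hardChoices N (p * 2) 0).card := by exact_mod_cast h1
    linarith
  have hwrong : 9999 * (∑ x, ∑ y, if q'.run x y then blockSum disjWeight interWeight N x y
      else N * blockProd disjWeight N x y) < N * (2 * T) := by
    rw [← sum_wrong q q' hrun]
    rw [mean_hardMixture] at herr
    have := (ENNReal.toReal_lt_toReal herr.ne_top (by simp)).2 herr
    have hfin : ∀ w : Fin N → Fin (p * 2) × Finset (Fin (p * 2)),
        (if q.run (assembleAlice w) (assembleBob w) = disj N (p * 2) (assembleAlice w)
          (assembleBob w) then (0 : ℝ≥0∞) else 1) ≠ ∞ := fun w => by split_ifs <;> simp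
    have hfin' : ∀ k : Fin N, ((hardChoices N (p * 2) k).card : ℝ≥0∞)⁻¹ *
        ∑ w ∈ hardChoices N (p * 2) k, (if q.run (assembleAlice w) (assembleBob w) =
          disj N (p * 2) (assembleAlice w) (assembleBob w) then (0 : ℝ≥0∞) else 1) ≠ ∞ := fun k => by
      refine ENNReal.mul_ne_top ?_ (ENNReal.sum_ne_top.2 fun w _ => hfin w)
      have := (hardChoices_nonempty N (p * 2) k).card_pos
      simp only [ne_eq, ENNReal.inv_eq_top, Nat.cast_eq_zero]
      omega
    rw [ENNReal.toReal_mul, ENNReal.toReal_sum fun k _ => hfin' k] at this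
    simp only [ENNReal.toReal_mul, ENNReal.toReal_inv, ENNReal.toReal_natCast,
      ENNReal.toReal_sum fun w _ => hfin w, card_hardChoices, apply_ite ENNReal.toReal,
      ENNReal.toReal_zero, ENNReal.toReal_one, ENNReal.toReal_div, ENNReal.toReal_ofNat,
      ← hT, ← Finset.mul_sum] at this
    rw [inv_mul_lt_iff₀ hNpos, inv_mul_lt_iff₀ (by positivity)] at this
    linarith
  have key := protocol_corruption disjWeight_nonneg (inv_nonneg.2 hA.le) (inv_nonneg.2 hQ.le)
    sum_disjWeight_left sum_disjWeight_right
    (block_corruption (ι := Fin p) hA hQ (by simpa using hp)) N q'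
    (a := a) (b := b) (fun x y => by rw [Protocol.aliceBits_comap]; exact ha q hq _ _)
    (fun x y => by rw [Protocol.bobBits_comap]; exact hb q hq _ _)
  rw [← hT] at key
  -- Wrong answers are accepted intersecting inputs and rejected disjoint ones; multiplying both by
  -- `16` bounds the total loss from above.
  have hlow : N * T - 16 * (∑ x, ∑ y, if q'.run x y then blockSum disjWeight interWeight N x y
      else N * blockProd disjWeight N x y) ≤ ∑ x, ∑ y, if q'.run x y then
        N * blockProd disjWeight N x y - blockSum disjWeight (fun s t => 16 * interWeight s t) N x y
        else 0 := by
    rw [hT]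
    simp only [Finset.mul_sum, ← Finset.sum_sub_distrib]
    refine Finset.sum_le_sum fun x _ => Finset.sum_le_sum fun y _ => ?_
    have h1 : blockSum disjWeight (fun s t => 16 * interWeight s t) N x y =
        16 * blockSum disjWeight interWeight N x y := by
      simp only [blockSum, Finset.mul_sum]
      refine Finset.sum_congr rfl fun k _ => ?_
      rw [prod_ite_eq_mul_erase, prod_ite_eq_mul_erase, mul_assoc]
    have h2 : 0 ≤ blockProd disjWeight N x y :=
      Finset.prod_nonneg fun i _ => disjWeight_nonneg _ _
    split_ifs
    · rw [h1]
    · have := mul_nonneg hNpos.le h2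
      linarith
  have hlog2 : log 2 ≤ 1 := by
    have := log_le_sub_one_of_pos (two_pos (α := ℝ))
    linarith
  have hnn : 0 ≤ A⁻¹ * a + Q⁻¹ * b := by positivity
  have h1 : log 2 * (A⁻¹ * a + Q⁻¹ * b) * T ≤ (A⁻¹ * a + Q⁻¹ * b) * T := by
    have := mul_le_mul_of_nonneg_right hlog2 (mul_nonneg hnn hTpos.le)
    linarith
  -- By `hwrong` the loss is below `(32 / 9999) N T`, far less than half of `N T`.
  have h2 : N / 2 * T < (A⁻¹ * a + Q⁻¹ * b) * T := by
    have := mul_pos hNpos hTpos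
    linarith
  have h3 := lt_of_mul_lt_mul_right h2 hTpos.le
  by_contra! hcon
  have h4 : A⁻¹ * a < N / 4 := by
    rw [inv_mul_lt_iff₀ hA]
    linarith [hcon.1]
  have h5 : Q⁻¹ * b < N / 4 := by
    rw [inv_mul_lt_iff₀ hQ]
    linarith [hcon.2]
  linarith

end Bridge

end LSD

/-! ### Error reduction by majorities of three -/

namespace Protocol

variable {X Y : Type}

/-- Run a protocol and continue according to its output. -/
def andThen : Protocol X Y → (Bool → Protocol X Y) → Protocol X Y
  | output v, k => k v
  | alice msg next, k => alice msg fun b => (next b).andThen k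
  | bob msg next, k => bob msg fun b => (next b).andThen k

theorem run_andThen (p : Protocol X Y) (k : Bool → Protocol X Y) (x : X) (y : Y) :
    (p.andThen k).run x y = (k (p.run x y)).run x y := by
  induction p with
  | output o => rfl
  | alice msg next ih => exact ih _
  | bob msg next ih => exact ih _

theorem aliceBits_andThen (p : Protocol X Y) (k : Bool → Protocol X Y) (x : X) (y : Y) :
    (p.andThen k).aliceBits x y = p.aliceBits x y + (k (p.run x y)).aliceBits x y := by
  induction p with
  | output o => exact (zero_add _).symm
  | alice msg next ih => exact (congrArg (· + 1) (ih _)).trans (add_right_comm _ _ _)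
  | bob msg next ih => exact ih _

theorem bobBits_andThen (p : Protocol X Y) (k : Bool → Protocol X Y) (x : X) (y : Y) :
    (p.andThen k).bobBits x y = p.bobBits x y + (k (p.run x y)).bobBits x y := by
  induction p with
  | output o => exact (zero_add _).symm
  | alice msg next ih => exact ih _
  | bob msg next ih => exact (congrArg (· + 1) (ih _)).trans (add_right_comm _ _ _)

/-- The majority of the outputs of three protocols. -/
def majority (p q r : Protocol X Y) : Protocol X Y :=
  p.andThen fun u => q.andThen fun v => r.andThen fun w => output (u && v || u && w || v && w)

theorem run_majority (p q r : Protocol X Y) (x : X) (y : Y) :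
    (majority p q r).run x y =
      (p.run x y && q.run x y || p.run x y && r.run x y || q.run x y && r.run x y) := by
  simp only [majority, run_andThen]
  rfl

theorem aliceBits_majority (p q r : Protocol X Y) (x : X) (y : Y) :
    (majority p q r).aliceBits x y = p.aliceBits x y + (q.aliceBits x y + r.aliceBits x y) := by
  simp only [majority, aliceBits_andThen]
  rfl

theorem bobBits_majority (p q r : Protocol X Y) (x : X) (y : Y) :
    (majority p q r).bobBits x y = p.bobBits x y + (q.bobBits x y + r.bobBits x y) := by
  simp only [majority, bobBits_andThen]
  rfl

end Protocol

namespace RandProtocol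

variable {X Y X' Y' : Type}

/-- The majority of three independent runs. -/
noncomputable def majority (P : RandProtocol X Y) : RandProtocol X Y :=
  P.bind fun p => P.bind fun q => P.map fun r => p.majority q r

theorem mem_support_majority {P : RandProtocol X Y} {m : Protocol X Y}
    (hm : m ∈ P.majority.support) :
    ∃ p ∈ P.support, ∃ q ∈ P.support, ∃ r ∈ P.support, p.majority q r = m := by
  simpa [majority, PMF.mem_support_bind_iff, PMF.mem_support_map_iff] using hm

theorem AliceSendsAtMost.majority {P : RandProtocol X Y} {a : ℕ} (h : P.AliceSendsAtMost a) :
    P.majority.AliceSendsAtMost (3 * a) := by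
  intro m hm x y
  obtain ⟨p, hp, q, hq, r, hr, rfl⟩ := mem_support_majority hm
  have := h p hp x y
  have := h q hq x y
  have := h r hr x y
  rw [Protocol.aliceBits_majority]
  omega

theorem BobSendsAtMost.majority {P : RandProtocol X Y} {b : ℕ} (h : P.BobSendsAtMost b) :
    P.majority.BobSendsAtMost (3 * b) := by
  intro m hm x y
  obtain ⟨p, hp, q, hq, r, hr, rfl⟩ := mem_support_majority hm
  have := h p hp x y
  have := h q hq x y
  have := h r hr x y
  rw [Protocol.bobBits_majority]
  omega

/-- The probability of a correct output. -/
noncomputable def successProb (P : RandProtocol X Y) (f : X → Y → Bool) (x : X) (y : Y) : ℝ≥0∞ :=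
  P.mean fun p => if p.run x y = f x y then 1 else 0

theorem errorProb_add_successProb (P : RandProtocol X Y) (f : X → Y → Bool) (x : X) (y : Y) :
    P.errorProb f x y + P.successProb f x y = 1 := by
  rw [errorProb_eq_mean, successProb, ← PMF.mean_const P 1]
  simp only [PMF.mean, ← ENNReal.tsum_add, ← mul_add]
  refine tsum_congr fun p => ?_
  split_ifs <;> simp

theorem mean_ite (P : RandProtocol X Y) (f : X → Y → Bool) (x : X) (y : Y) (α β : ℝ≥0∞) :
    (P.mean fun p => if p.run x y = f x y then α else β) =
      P.errorProb f x y * β + P.successProb f x y * α := by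
  rw [errorProb_eq_mean, successProb]
  simp only [PMF.mean, ← ENNReal.tsum_mul_right, ← ENNReal.tsum_add]
  refine tsum_congr fun p => ?_
  split_ifs <;> simp

/-- With error `e` and success `s`, at least two of three runs err with probability `e³ + 3e²s =
e²(1 + 2s)`, as `e + s = 1`. This form avoids truncated subtraction in `ℝ≥0∞`. -/
theorem errorProb_majority (P : RandProtocol X Y) (f : X → Y → Bool) (x : X) (y : Y) :
    P.majority.errorProb f x y = P.errorProb f x y * P.errorProb f x y *
      (1 + 2 * P.successProb f x y) := by
  have hmaj : ∀ p q r : Protocol X Y,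
      (if (p.majority q r).run x y = f x y then (0 : ℝ≥0∞) else 1) =
        if r.run x y = f x y then
          if q.run x y = f x y then 0 else if p.run x y = f x y then 0 else 1
        else if q.run x y = f x y then if p.run x y = f x y then 0 else 1 else 1 := by
    intro p q r
    rw [Protocol.run_majority]
    cases p.run x y <;> cases q.run x y <;> cases r.run x y <;> cases f x y <;> rfl
  rw [errorProb_eq_mean, majority]
  simp only [PMF.mean_bind, PMF.mean_map, hmaj, mean_ite]
  have h1 : ∀ p q : Protocol X Y, (P.errorProb f x y *
        (if q.run x y = f x y then if p.run x y = f x y then 0 else 1 else 1) +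
      P.successProb f x y *
        (if q.run x y = f x y then 0 else if p.run x y = f x y then 0 else 1)) =
      if q.run x y = f x y then if p.run x y = f x y then 0 else P.errorProb f x y
      else if p.run x y = f x y then P.errorProb f x y else 1 := by
    intro p q
    split_ifs <;> simp [errorProb_add_successProb]
  simp only [h1, mean_ite]
  have h2 : ∀ p : Protocol X Y, (P.errorProb f x y *
        (if p.run x y = f x y then P.errorProb f x y else 1) +
      P.successProb f x y * (if p.run x y = f x y then 0 else P.errorProb f x y)) =
      if p.run x y = f x y then P.errorProb f x y * P.errorProb f x y
      else P.errorProb f x y + P.successProb f x y * P.errorProb f x y := by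
    intro p
    split_ifs <;> simp
  simp only [h2, mean_ite]
  ring

theorem toReal_errorProb_majority (P : RandProtocol X Y) (f : X → Y → Bool) (x : X) (y : Y) :
    (P.majority.errorProb f x y).toReal = (P.errorProb f x y).toReal ^ 2 *
      (3 - 2 * (P.errorProb f x y).toReal) := by
  have h := P.errorProb_add_successProb f x y
  have he : P.errorProb f x y ≠ ∞ := fun h' => by simp [h'] at h
  have hs : P.successProb f x y ≠ ∞ := fun h' => by simp [h'] at h
  have h' := congrArg ENNReal.toReal h
  rw [ENNReal.toReal_add he hs, ENNReal.toReal_one] at h'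
  rw [errorProb_majority, ENNReal.toReal_mul, ENNReal.toReal_mul,
    ENNReal.toReal_add ENNReal.one_ne_top (ENNReal.mul_ne_top (by simp) hs), ENNReal.toReal_mul,
    ENNReal.toReal_one, ENNReal.toReal_ofNat, eq_sub_of_add_eq' h']
  ring

/-- Repeated majorities reduce the error geometrically. -/
theorem exists_amplified {f : X → Y → Bool} {ε : ℝ} (hε : ε < 1 / 2) (P : RandProtocol X Y)
    {a b : ℕ} (ha : P.AliceSendsAtMost a) (hb : P.BobSendsAtMost b)
    (hP : ∀ x y, (P.errorProb f x y).toReal ≤ ε) (m : ℕ) :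
    ∃ P' : RandProtocol X Y, P'.AliceSendsAtMost (3 ^ m * a) ∧ P'.BobSendsAtMost (3 ^ m * b) ∧
      ∀ x y, (P'.errorProb f x y).toReal ≤ (3 * ε - 2 * ε ^ 2) ^ m * ε := by
  induction m with
  | zero => exact ⟨P, by simpa using ha, by simpa using hb, by simpa using hP⟩
  | succ m ih =>
    obtain ⟨P', ha', hb', hP'⟩ := ih
    refine ⟨P'.majority, ?_, ?_, fun x y => ?_⟩
    · rw [pow_succ', mul_assoc]; exact ha'.majority
    · rw [pow_succ', mul_assoc]; exact hb'.majority
    · have he0 : 0 ≤ (P'.errorProb f x y).toReal := ENNReal.toReal_nonneg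
      have hε0 : 0 ≤ ε := ENNReal.toReal_nonneg.trans (hP x y)
      have hρ0 : 0 ≤ 3 * ε - 2 * ε ^ 2 := by nlinarith
      have hρ1 : 3 * ε - 2 * ε ^ 2 ≤ 1 := by nlinarith
      have he := hP' x y
      have heε : (P'.errorProb f x y).toReal ≤ ε :=
        he.trans (mul_le_of_le_one_left hε0 (pow_le_one₀ hρ0 hρ1))
      rw [toReal_errorProb_majority]
      generalize (P'.errorProb f x y).toReal = e at *
      -- The function `t (3 - 2t)` increases up to `t = 3/4`, and `e ≤ ε < 1/2`.
      have h1 : e * (3 - 2 * e) ≤ 3 * ε - 2 * ε ^ 2 := by nlinarith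
      calc e ^ 2 * (3 - 2 * e) = e * (3 - 2 * e) * e := by ring
        _ ≤ (3 * ε - 2 * ε ^ 2) * ((3 * ε - 2 * ε ^ 2) ^ m * ε) := by gcongr
        _ = _ := by ring

theorem distError_le {P : RandProtocol X Y} {f : X → Y → Bool} (D : PMF (X × Y)) {c : ℝ≥0∞}
    (h : ∀ x y, P.errorProb f x y ≤ c) : P.distError f D ≤ c := by
  rw [← PMF.mean_const D c]
  exact ENNReal.tsum_le_tsum fun z => mul_le_mul_right (h z.1 z.2) _

/-- The randomized protocol in which the parties first translate their inputs. -/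
noncomputable def comap (u : X' → X) (v : Y' → Y) (P : RandProtocol X Y) : RandProtocol X' Y' :=
  P.map fun p => p.comap u v

theorem errorProb_comap (u : X' → X) (v : Y' → Y) (P : RandProtocol X Y) (f : X → Y → Bool)
    (x : X') (y : Y') :
    (P.comap u v).errorProb (fun x y => f (u x) (v y)) x y = P.errorProb f (u x) (v y) := by
  rw [errorProb_eq_mean, errorProb_eq_mean, comap, PMF.mean_map]
  simp only [Protocol.run_comap]

theorem AliceSendsAtMost.comap {P : RandProtocol X Y} {a : ℕ} (h : P.AliceSendsAtMost a)
    (u : X' → X) (v : Y' → Y) : (P.comap u v).AliceSendsAtMost a := by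
  intro m hm x y
  obtain ⟨p, hp, rfl⟩ := (PMF.mem_support_map_iff _ _ _).1 hm
  rw [Protocol.aliceBits_comap]
  exact h p hp _ _

theorem BobSendsAtMost.comap {P : RandProtocol X Y} {b : ℕ} (h : P.BobSendsAtMost b)
    (u : X' → X) (v : Y' → Y) : (P.comap u v).BobSendsAtMost b := by
  intro m hm x y
  obtain ⟨p, hp, rfl⟩ := (PMF.mem_support_map_iff _ _ _).1 hm
  rw [Protocol.bobBits_comap]
  exact h p hp _ _

end RandProtocol

/-! ### Choice of parameters and the two bounds -/

namespace LSD

open Real Filter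

/-- A protocol for larger blocks can be used for smaller blocks. -/
theorem exists_smaller {N B B' : ℕ} (hB : B' ≤ B)
    (P : RandProtocol (AliceInput N B) (BobInput N B)) {a b : ℕ} {c : ℝ≥0∞}
    (ha : P.AliceSendsAtMost a) (hb : P.BobSendsAtMost b)
    (hP : ∀ S T, P.errorProb (disj N B) S T ≤ c) :
    ∃ P' : RandProtocol (AliceInput N B') (BobInput N B'), P'.AliceSendsAtMost a ∧
      P'.BobSendsAtMost b ∧ ∀ S T, P'.errorProb (disj N B') S T ≤ c := by
  let e : Fin (N * B') ↪ Fin (N * B) := Fin.castLEEmb (Nat.mul_le_mul_left N hB)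
  let u : AliceInput N B' → AliceInput N B := fun S => ⟨S.1.map e, by rw [Finset.card_map, S.2]⟩
  let v : BobInput N B' → BobInput N B := fun T => T.map e
  refine ⟨P.comap u v, ha.comap u v, hb.comap u v, fun S T => ?_⟩
  have hd : disj N B' = fun S T => disj N B (u S) (v T) := by
    funext S T
    simp only [disj, u, v, Finset.disjoint_map]
  rw [hd, RandProtocol.errorProb_comap]
  exact hP _ _

/-- The trade-off is applied with `A = 4δ lg B` and `Q = 4 B ^ (1 - 19δ)`, where the factors `4`
cancel those in its conclusion. Since `3A ≤ 18δ log B`, the size condition needs `B` to exceed a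
constant times `B ^ (1 - δ)`: `18` comes from the exponential, and one more `δ` absorbs constants.
-/
theorem distributional_bound {δ : ℝ} (hδ : 0 < δ) (hδ' : 19 * δ < 1) :
    ∃ B₀ : ℕ, ∀ (N B : ℕ) [NeZero N] [NeZero B], B₀ ≤ B → Even B →
      ∀ (P : RandProtocol (AliceInput N B) (BobInput N B)) (a b : ℕ),
        P.AliceSendsAtMost a → P.BobSendsAtMost b →
        P.distError (disj N B) (hardMixture N B) < 1 / 9999 →
        δ * N * logb 2 B ≤ a ∨ N * (B : ℝ) ^ (1 - 19 * δ) ≤ b := by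
  -- `738 = 2 * (92 * 4 + 1)`; the factor `2` is there because a block has `B / 2` pairs.
  obtain ⟨B₀, hB₀⟩ := eventually_atTop.1 (((tendsto_rpow_atTop hδ).comp
    tendsto_natCast_atTop_atTop).eventually_ge_atTop (738 * exp 3))
  refine ⟨max B₀ 2, fun N B _ _ hB hev P a b ha hb hP => ?_⟩
  obtain ⟨p, rfl⟩ : ∃ p, B = p * 2 := by
    obtain ⟨p, hp⟩ := hev
    exact ⟨p, by omega⟩
  have hpow := hB₀ _ ((le_max_left _ _).trans hB)
  have hB2 : (2 : ℝ) ≤ (p * 2 : ℕ) := by exact_mod_cast (le_max_right B₀ 2).trans hB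
  have hp2 : (p : ℝ) = (p * 2 : ℕ) / 2 := by push_cast; ring
  simp only [Function.comp_apply] at hpow
  set x : ℝ := ((p * 2 : ℕ) : ℝ)
  have hx0 : 0 < x := by linarith
  have hlog : 0 < log x := log_pos (by linarith)
  have hlog2 : 2 / 3 ≤ log 2 := by linarith [log_two_gt_d9]
  have hA : 0 < 4 * δ * logb 2 x := by
    have := logb_pos one_lt_two (show 1 < x by linarith)
    positivity
  have hQ : 0 < 4 * x ^ (1 - 19 * δ) := by positivity
  have hexp : exp (3 * (4 * δ * logb 2 x + 1)) ≤ exp 3 * x ^ (18 * δ) := by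
    rw [rpow_def_of_pos hx0, ← exp_add]
    refine exp_le_exp.2 ?_
    have h1 : logb 2 x ≤ 3 / 2 * log x := by
      rw [logb, div_le_iff₀ (by linarith)]
      nlinarith
    nlinarith
  have hcond : exp (3 * (4 * δ * logb 2 x + 1)) * (92 * (4 * x ^ (1 - 19 * δ)) + 1) ≤ p := by
    have h1 : x ^ (18 * δ) * x ^ (1 - 19 * δ) = x ^ (1 - δ) := by
      rw [← rpow_add hx0]; congr 1; ring
    have h2 : x ^ (18 * δ) ≤ x ^ (1 - δ) :=
      rpow_le_rpow_of_exponent_le (by linarith) (by linarith)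
    have h3 : x ^ δ * x ^ (1 - δ) = x := by
      rw [← rpow_add hx0]; simp
    have h4 : 738 * exp 3 * x ^ (1 - δ) ≤ x := by
      have := mul_le_mul_of_nonneg_right hpow (rpow_nonneg hx0.le (1 - δ))
      rwa [h3] at this
    calc _ ≤ exp 3 * x ^ (18 * δ) * (92 * (4 * x ^ (1 - 19 * δ)) + 1) := by gcongr
      _ = exp 3 * (368 * (x ^ (18 * δ) * x ^ (1 - 19 * δ)) + x ^ (18 * δ)) := by ring
      _ ≤ exp 3 * (368 * x ^ (1 - δ) + x ^ (1 - δ)) := by rw [h1]; gcongr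
      _ ≤ p := by rw [hp2]; linarith
  rcases communication_tradeoff hA hQ hcond P ha hb hP with h | h
  · left; linarith
  · right; linarith

theorem randomized_bound {ε : ℝ≥0∞} (hε : ε < 1 / 2) :
    ∃ C : ℝ, 0 < C ∧ ∀ δ : ℝ, 0 < δ → C * δ < 1 →
      ∃ B₀ : ℕ, ∀ (N B : ℕ) [NeZero N] [NeZero B], B₀ ≤ B →
        ∀ (P : RandProtocol (AliceInput N B) (BobInput N B)) (a b : ℕ),
          P.AliceSendsAtMost a → P.BobSendsAtMost b →
          (∀ S T, P.errorProb (disj N B) S T ≤ ε) →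
          δ * N * logb 2 B ≤ a ∨ N * (B : ℝ) ^ (1 - C * δ) ≤ b := by
  have hε' : ε.toReal < 1 / 2 := by
    have := (ENNReal.toReal_lt_toReal hε.ne_top (by simp)).2 hε
    simpa using this
  have hε0 : 0 ≤ ε.toReal := ENNReal.toReal_nonneg
  obtain ⟨m, hm⟩ : ∃ m : ℕ, (3 * ε.toReal - 2 * ε.toReal ^ 2) ^ m < 1 / 9999 :=
    exists_pow_lt_of_lt_one (by norm_num) (by nlinarith)
  have hρ0 : 0 ≤ 3 * ε.toReal - 2 * ε.toReal ^ 2 := by nlinarith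
  have hm' : (3 * ε.toReal - 2 * ε.toReal ^ 2) ^ m * ε.toReal < 1 / 9999 := by
    have := pow_nonneg hρ0 m
    nlinarith
  have hr0 : (0 : ℝ) < 3 ^ m := by positivity
  -- With `r = 3 ^ m`, the distributional bound is used at `2 r δ`: `r` pays for the amplification,
  -- `2` for rounding `B` down to an even number. This costs `38 r δ` in the exponent; a further `r
  -- δ` absorbs the factor `2 r`.
  refine ⟨39 * 3 ^ m, by positivity, fun δ hδ hCδ => ?_⟩
  set r : ℝ := 3 ^ m with hr
  have hrδ : 0 < r * δ := mul_pos hr0 hδ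
  obtain ⟨B₁, hB₁⟩ := distributional_bound (δ := 2 * r * δ) (by positivity) (by linarith)
  obtain ⟨B₂, hB₂⟩ := eventually_atTop.1 (((tendsto_rpow_atTop hrδ).comp
    tendsto_natCast_atTop_atTop).eventually_ge_atTop (2 * r))
  refine ⟨max (B₁ + 1) (max B₂ 4), fun N B _ _ hB P a b ha hb hP => ?_⟩
  have hBB₁ : B₁ + 1 ≤ B := (le_max_left _ _).trans hB
  have hBB₂ : B₂ ≤ B := (le_max_left _ _).trans ((le_max_right _ _).trans hB)
  have hB4 : 4 ≤ B := (le_max_right _ _).trans ((le_max_right _ _).trans hB)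
  obtain ⟨P₁, ha₁, hb₁, hP₁⟩ := P.exists_amplified hε' ha hb
    (fun S T => ENNReal.toReal_mono hε.ne_top (hP S T)) m
  have hfin : ∀ S T, P₁.errorProb (disj N B) S T ≠ ∞ := fun S T h => by
    have := P₁.errorProb_add_successProb (disj N B) S T
    simp [h] at this
  obtain ⟨P₂, ha₂, hb₂, hP₂⟩ := exists_smaller (B' := B / 2 * 2) (by omega) P₁ ha₁ hb₁
    fun S T => (ENNReal.le_ofReal_iff_toReal_le (hfin S T)
      (ENNReal.toReal_nonneg.trans (hP₁ S T))).2 (hP₁ S T)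
  have : NeZero (B / 2 * 2) := ⟨by omega⟩
  have hdist : P₂.distError (disj N (B / 2 * 2)) (hardMixture N (B / 2 * 2)) < 1 / 9999 := by
    refine (RandProtocol.distError_le _ hP₂).trans_lt ?_
    rw [ENNReal.ofReal_lt_iff_lt_toReal (mul_nonneg (pow_nonneg hρ0 m) hε0) (by simp)]
    simpa using hm'
  have hpow := hB₂ B hBB₂
  simp only [Function.comp_apply] at hpow
  have hB4' : (4 : ℝ) ≤ B := by exact_mod_cast hB4
  have hB' : (B : ℝ) / 2 ≤ (B / 2 * 2 : ℕ) := by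
    have : B ≤ 2 * (B / 2 * 2) := by omega
    have : (B : ℝ) ≤ 2 * (B / 2 * 2 : ℕ) := by exact_mod_cast this
    linarith
  have hN : (0 : ℝ) < N := by exact_mod_cast Nat.pos_of_ne_zero (NeZero.ne N)
  have hB0 : (0 : ℝ) < B := by linarith
  rcases hB₁ N (B / 2 * 2) (by omega) (even_two.mul_left _) P₂ _ _ ha₂ hb₂ hdist with h | h
  · left
    generalize ((B / 2 * 2 : ℕ) : ℝ) = y at *
    -- `y ≥ B / 2` and `B ≥ 4` give `B ≤ y ^ 2`.
    have h1 : logb 2 B ≤ 2 * logb 2 y := by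
      rw [← logb_rpow_eq_mul_logb_of_pos (by linarith)]
      refine logb_le_logb_of_le one_lt_two hB0 ?_
      norm_num
      nlinarith
    have h2 : r * (δ * N * logb 2 B) ≤ r * a := by
      calc r * (δ * N * logb 2 B) ≤ r * (δ * N * (2 * logb 2 y)) := by gcongr
        _ = 2 * r * δ * N * logb 2 y := by ring
        _ ≤ _ := h
        _ = r * a := by push_cast; rfl
    exact le_of_mul_le_mul_left h2 hr0
  · right
    generalize ((B / 2 * 2 : ℕ) : ℝ) = y at *
    have hs0 : 0 ≤ 1 - 19 * (2 * r * δ) := by linarith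
    have h1 : (B : ℝ) ^ (1 - 19 * (2 * r * δ)) / 2 ≤ y ^ (1 - 19 * (2 * r * δ)) := by
      refine le_trans ?_ (rpow_le_rpow (by linarith) hB' hs0)
      rw [div_rpow hB0.le zero_le_two]
      have : (2 : ℝ) ^ (1 - 19 * (2 * r * δ)) ≤ 2 ^ (1 : ℝ) :=
        rpow_le_rpow_of_exponent_le one_le_two (by linarith)
      rw [rpow_one] at this
      gcongr
    have h2 : (B : ℝ) ^ (1 - 19 * (2 * r * δ)) = B ^ (r * δ) * B ^ (1 - 39 * r * δ) := by
      rw [← rpow_add hB0]; congr 1; ring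
    have h3 : r * (N * (B : ℝ) ^ (1 - 39 * r * δ)) ≤ r * b := by
      calc r * (N * (B : ℝ) ^ (1 - 39 * r * δ))
          = N * (2 * r * (B : ℝ) ^ (1 - 39 * r * δ) / 2) := by ring
        _ ≤ N * (B ^ (r * δ) * (B : ℝ) ^ (1 - 39 * r * δ) / 2) := by gcongr
        _ ≤ N * y ^ (1 - 19 * (2 * r * δ)) := by rw [← h2]; gcongr
        _ ≤ _ := h
        _ = r * b := by push_cast; rfl
    exact le_of_mul_le_mul_left h3 hr0

end LSD

theorem mainTheorem1 :
    (∀ ε : ℝ≥0∞, ε < 1 / 2 →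
      ∃ C : ℝ, 0 < C ∧ ∀ δ : ℝ, 0 < δ → C * δ < 1 →
        ∃ B₀ : ℕ, ∀ (N B : ℕ) [NeZero N] [NeZero B], B₀ ≤ B →
          ∀ (P : RandProtocol (LSD.AliceInput N B) (LSD.BobInput N B)) (a b : ℕ),
            P.AliceSendsAtMost a → P.BobSendsAtMost b →
            (∀ S T, P.errorProb (LSD.disj N B) S T ≤ ε) →
            δ * N * Real.logb 2 B ≤ a ∨ N * (B : ℝ) ^ (1 - C * δ) ≤ b) ∧
    (∃ C : ℝ, 0 < C ∧ ∀ δ : ℝ, 0 < δ → C * δ < 1 →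
      ∃ B₀ : ℕ, ∀ (N B : ℕ) [NeZero N] [NeZero B], B₀ ≤ B → Even B →
        ∀ (P : RandProtocol (LSD.AliceInput N B) (LSD.BobInput N B)) (a b : ℕ),
          P.AliceSendsAtMost a → P.BobSendsAtMost b →
          P.distError (LSD.disj N B) (LSD.hardMixture N B) < 1 / 9999 →
          δ * N * Real.logb 2 B ≤ a ∨ N * (B : ℝ) ^ (1 - C * δ) ≤ b) :=
  ⟨fun _ hε => LSD.randomized_bound hε,
    19, by norm_num, fun _ hδ hδ' => LSD.distributional_bound hδ hδ'⟩
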